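/- Let $\mathcal P=(P,\preceq)$ be a finite poset, let $P^*\subseteq P$ be a set of marked elements containing all minimal and all maximal elements of $\mathcal P$, and let $\lambda:P^*\to\mathbb R$ be order preserving. The marked order polytope is $$O(\mathcal P,\lambda)=\{x\in\mathbb R^P : x_p\le x_q \text{ if } p\preceq q,\ x_a=\lambda(a)\text{ if }a\in P^*\}.$$ A chain $L=(\emptyset=I_0\subsetneq I_1\subsetneq\dots\subsetneq I_m=P)$ of order ideals (lower sets) of $\mathcal P$ is called $\lambda$-admissible if each set $\lambda((I_i\setminus I_{i-1})\cap P^*)$ is empty or a singleton $\{t_i\}$, and $t_i<t_j$ whenever $i<j$ and both are defined. Its dimension $\dim L$ is the number of differences $I_i\setminus I_{i-1}$ disjoint from $P^*$. Let $F_L\subset\mathbb R^P$ be the set of all $x$ with $x|_{P^*}=\lambda$ that are constant on every $I_i\setminus I_{i-1}$ and satisfy $x(I_1)\le x(I_2\setminus I_1)\le\dots\le x(P\setminus I_{m-1})$. Let $\mathcal K_{\mathcal P,\lambda}$ be the family of all $F_L$ with $L$ a $\lambda$-admissible chain (the cubosimplicial subdivision of $O(\mathcal P,\lambda)$). An $I_k$-condensation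 of a $\lambda$-admissible chain $L$ is a $\lambda$-admissible chain obtained from $L$ by adding a single ideal $J$ with $I_{k-1}\subsetneq J\subsetneq I_k$; its dimension is $\dim L+1$. Two $I_k$-condensations of $L$, obtained by adding $J$ and $J'$, are $I_k$-conjugate if $I_k\setminus J=J'\setminus I_{k-1}$ and $J\setminus I_{k-1}=I_k\setminus J'$. Let $C^i(\mathcal P,\lambda)$ be the $\mathbb Z_2$-vector space with basis the $\lambda$-admissible chains of dimension $i$, and let $\delta:C^i(\mathcal P,\lambda)\to C^{i+1}(\mathcal P,\lambda)$ be the linear map with $\delta(L)=\Sigma_1(L)+\dots+\Sigma_m(L)$, where $\Sigma_k(L)$ is the formal sum of all $I_k$-condensations of $L$ that have an $I_k$-conjugate. For a subdivision $\mathcal K$ of a convex polytope $M$, let $$C^*_{\mathcal K}=\bigoplus_{A}C^*(\mathcal A',\partial\mathcal A';\mathbb Z_2),$$ where $A$ runs over all nonempty faces of $M$ (including $M$), $\mathcal A'$ consists of the members of $\mathcal K$ contained in $A$, $\partial\mathcal A'$ consists of the members of $\mathcal K$ contained in the relative boundary of $A$, and $C^*(\mathcal A',\partial\mathcal A';\mathbb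 Z_2)$ is the complex of relative cellular cochains (the cells are the relative interiors of the polytopes). Theorem. $C^*(\mathcal P,\lambda)$ is a cochain complex, i.e. $\delta\circ\delta=0$, and it is isomorphic to the complex $C^*_{\mathcal K_{\mathcal P,\lambda}}$. Moreover, for every $n\ge 0$, $\dim_{\mathbb Z_2}H^n(C^*(\mathcal P,\lambda))$ equals the number $f_n$ of $n$-dimensional faces of $O(\mathcal P,\lambda)$. -/

import Mathlib

set_option maxSynthPendingDepth 3

namespace MarkedPoset

section Polyhedra

variable {E : Type*} [AddCommGroup E] [Module ℝ E] [TopologicalSpace E]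

/-- `A` is a (nonempty) face of the polyhedron `M`: the set of maximizers on `M` of a continuous
linear functional (the zero functional gives `M` itself). -/
def IsFace (M A : Set E) : Prop :=
  A.Nonempty ∧ IsExposed ℝ M A

/-- The dimension of a polyhedron, i.e. of its affine hull. -/
noncomputable def polyDim (A : Set E) : ℕ :=
  Module.finrank ℝ (affineSpan ℝ A).direction

/-- The number `f_n(M)` of `n`-dimensional faces of `M`. -/
noncomputable def faceNumber (M : Set E) (n : ℕ) : ℕ∞ :=
  {A : Set E | IsFace M A ∧ polyDim A = n}.encard

/-- The `n`-cells of the pair `(K, K₀)`: the `n`-dimensional members of `K` outside `K₀`. -/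
def RelCell (K K₀ : Finset (Set E)) (n : ℕ) : Type _ :=
  {Q : Set E // Q ∈ K ∧ Q ∉ K₀ ∧ polyDim Q = n}

noncomputable instance (K K₀ : Finset (Set E)) (n : ℕ) : Fintype (RelCell K K₀ n) :=
  haveI : Finite (RelCell K K₀ n) :=
    Set.Finite.subset (t := {Q | Q ∈ K ∧ Q ∉ K₀ ∧ polyDim Q = n}) K.finite_toSet fun _ h => h.1
  Fintype.ofFinite _

/-- The cellular cochains `C^n(K, K₀; ℤ/2)` of a pair of polyhedral complexes. -/
abbrev RelCochain (K K₀ : Finset (Set E)) (n : ℕ) : Type _ :=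
  RelCell K K₀ n → ZMod 2

open Classical in
/-- The cellular coboundary mod 2 of a pair of polyhedral complexes: the value of `d c` on an
`(n+1)`-cell `Q` is the sum of the values of `c` on the `n`-cells that are faces of `Q`. -/
noncomputable def relCoboundary (K K₀ : Finset (Set E)) (n : ℕ) :
    RelCochain K K₀ n →ₗ[ZMod 2] RelCochain K K₀ (n + 1) where
  toFun c := fun Q => ∑ R : RelCell K K₀ n, if IsFace Q.1 R.1 then c R else 0
  map_add' c c' := by
    funext Q
    simp only [Pi.add_apply, ← Finset.sum_add_distrib]
    refine Finset.sum_congr rfl fun R _ => ?_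
    split_ifs <;> simp
  map_smul' a c := by
    funext Q
    simp [Finset.mul_sum]

open Classical in
/-- The subcomplex `𝒜'` of those members of `K` that lie in `A`. -/
noncomputable def subcomplexIn (K : Finset (Set E)) (A : Set E) : Finset (Set E) :=
  K.filter fun Q => Q ⊆ A

open Classical in
/-- The subcomplex `∂𝒜'` of those members of `𝒜'` that lie in the relative boundary of `A`. -/
noncomputable def subcomplexBoundary (K : Finset (Set E)) (A : Set E) : Finset (Set E) :=
  (subcomplexIn K A).filter fun Q => Q ⊆ intrinsicFrontier ℝ A

/-- The cochains `C^n_K = ⨁_A C^n(𝒜', ∂𝒜'; ℤ/2)` of a subdivision `K` of a polytope `M`;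
the sum runs over all faces `A` of `M`. -/
abbrev SubdivCochain (M : Set E) (K : Finset (Set E)) (n : ℕ) : Type _ :=
  DirectSum {A : Set E // IsFace M A}
    fun A => RelCochain (subcomplexIn K A.1) (subcomplexBoundary K A.1) n

open Classical in
/-- The differential of `C^*_K`: the direct sum of the cellular coboundaries. -/
noncomputable def subdivCoboundary (M : Set E) (K : Finset (Set E)) (n : ℕ) :
    SubdivCochain M K n →ₗ[ZMod 2] SubdivCochain M K (n + 1) :=
  DirectSum.lmap fun A : {A : Set E // IsFace M A} =>
    relCoboundary (subcomplexIn K A.1) (subcomplexBoundary K A.1) n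

end Polyhedra

section Chains

variable {P : Type*} [PartialOrder P]

/-- A chain `∅ = I₀ ⊊ I₁ ⊊ ⋯ ⊊ I_{m+1} = P` of order ideals (lower sets) of `P`, given as the
set of its members. -/
@[ext]
structure IdealChain (P : Type*) [PartialOrder P] where
  /-- the ideals of the chain -/
  ideals : Finset (LowerSet P)
  bot_mem : ⊥ ∈ ideals
  top_mem : ⊤ ∈ ideals
  isChain : IsChain (· ≤ ·) (ideals : Set (LowerSet P))

/-- `I` and `J` are neighbours in the chain, i.e. `I = I_{k-1}` and `J = I_k` for some `k`. -/
def IdealChain.IsStep (L : IdealChain P) (I J : LowerSet P) : Prop :=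
  I ∈ L.ideals ∧ J ∈ L.ideals ∧ I < J ∧ ∀ K ∈ L.ideals, ¬(I < K ∧ K < J)

/-- The difference `J \ I`. -/
def gap (I J : LowerSet P) : Set P := (J : Set P) \ (I : Set P)

variable {S : Set P} (lam : S → ℝ)

/-- The set of labels `λ((J \ I) ∩ P*)`. -/
def labels (I J : LowerSet P) : Set ℝ := lam '' {a : S | (a : P) ∈ gap I J}

/-- `λ`-admissibility: all marked elements of one difference of neighbouring ideals have the same
label, and labels strictly increase from one difference to a later one. -/
def IdealChain.IsAdmissible (L : IdealChain P) : Prop :=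
  (∀ I J, L.IsStep I J → (labels lam I J = ∅ ∨ ∃ t, labels lam I J = {t})) ∧
  ∀ I J I' J', L.IsStep I J → L.IsStep I' J' → J ≤ I' →
    ∀ t ∈ labels lam I J, ∀ t' ∈ labels lam I' J', t < t'

/-- The `λ`-admissible chains. -/
def AdmChain : Type _ := {L : IdealChain P // L.IsAdmissible lam}

instance [Finite P] : Finite (IdealChain P) :=
  Finite.of_injective IdealChain.ideals fun _ _ h => IdealChain.ext h

instance [Finite P] : Finite (AdmChain lam) :=
  inferInstanceAs (Finite {L : IdealChain P // L.IsAdmissible lam})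

noncomputable instance [Finite P] : Fintype (AdmChain lam) := Fintype.ofFinite _

/-- The marked order polytope `O(P, λ)`. -/
def orderPolytope : Set (P → ℝ) :=
  {x | (∀ p q, p ≤ q → x p ≤ x q) ∧ ∀ a : S, x a = lam a}

/-- The polytope `F_L`: extensions of `λ` that are constant on every difference of neighbouring
ideals and whose values weakly increase along successive differences. -/
def chainPolytope (L : IdealChain P) : Set (P → ℝ) :=
  {x | (∀ a : S, x a = lam a) ∧
    (∀ I J, L.IsStep I J → ∀ p ∈ gap I J, ∀ q ∈ gap I J, x p = x q) ∧
    ∀ I J K, L.IsStep I J → L.IsStep J K → ∀ p ∈ gap I J, ∀ q ∈ gap J K, x p ≤ x q}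

open Classical in
/-- The cubosimplicial subdivision `K_{P,λ}`: all `F_L` with `L` a `λ`-admissible chain. -/
noncomputable def cubosimplicial [Finite P] : Finset (Set (P → ℝ)) :=
  Finset.univ.image fun L : AdmChain lam => chainPolytope lam L.1

variable {lam}

/-- The dimension of a chain: the number of differences of neighbouring ideals that contain no
marked elements. -/
noncomputable def AdmChain.dim (L : AdmChain lam) : ℕ :=
  {s : LowerSet P × LowerSet P | L.1.IsStep s.1 s.2 ∧ gap s.1 s.2 ∩ S = ∅}.ncard

open Classical in
/-- With `K = I_k` and `I = I_{k-1}`: the chain `L'` is the `I_k`-condensation of `L` obtained by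
adding the single ideal `J`, where `I ⊊ J ⊊ K`. -/
def IsCondensation (L : AdmChain lam) (I K J : LowerSet P) (L' : AdmChain lam) : Prop :=
  L.1.IsStep I K ∧ I < J ∧ J < K ∧ L'.1.ideals = insert J L.1.ideals

/-- With `K = I_k`: the chain `L'` is an `I_k`-condensation of `L` that has an `I_k`-conjugate
`L''`, i.e. `L''` is an `I_k`-condensation of `L` in which the two parts of `I_k \ I_{k-1}` are
adjoined in the opposite order. -/
def HasConjugate (L : AdmChain lam) (K : LowerSet P) (L' : AdmChain lam) : Prop :=
  ∃ (I J : LowerSet P), IsCondensation L I K J L' ∧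
    ∃ (J' : LowerSet P) (L'' : AdmChain lam), IsCondensation L I K J' L'' ∧
      gap J K = gap I J' ∧ gap I J = gap J' K

theorem IsCondensation.isStep_iff {L L' : AdmChain lam} {I K J : LowerSet P}
    (h : IsCondensation L I K J L') (A B : LowerSet P) :
    L'.1.IsStep A B ↔
      (L.1.IsStep A B ∧ (A, B) ≠ (I, K)) ∨ (A, B) = (I, J) ∨ (A, B) = (J, K) := by
  classical
  obtain ⟨⟨hI, hK, hIK, hno⟩, hIJ, hJK, hL'⟩ := h
  have cmp : ∀ X ∈ L.1.ideals, X ≤ I ∨ K ≤ X := by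
    intro X hX
    by_contra! hc
    rcases L.1.isChain.total hX hI with h1 | h1
    · exact hc.1 h1
    · rcases L.1.isChain.total hX hK with h2 | h2
      · exact hno X hX ⟨lt_of_le_of_ne h1 fun e => hc.1 e.ge, lt_of_le_of_ne h2 fun e => hc.2 e.ge⟩
      · exact hc.2 h2
  have hJ : J ∉ L.1.ideals := fun hJ => hno J hJ ⟨hIJ, hJK⟩
  simp only [IdealChain.IsStep, hL', Finset.mem_insert, Prod.mk.injEq, ne_eq]
  constructor
  · rintro ⟨hA, hB, hAB, hn⟩
    rcases hA with rfl | hA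
    · rcases hB with rfl | hB
      · exact absurd hAB (lt_irrefl _)
      · right; right
        refine ⟨rfl, ?_⟩
        rcases cmp B hB with h1 | h1
        · exact absurd (hAB.trans_le h1) hIJ.asymm
        · by_contra hne
          exact hn K (Or.inr hK) ⟨hJK, lt_of_le_of_ne h1 fun e => hne e.symm⟩
    · rcases hB with rfl | hB
      · right; left
        refine ⟨?_, rfl⟩
        rcases cmp A hA with h1 | h1
        · by_contra hne
          exact hn I (Or.inr hI) ⟨lt_of_le_of_ne h1 hne, hIJ⟩
        · exact absurd (hAB.trans_le (hJK.le.trans h1)) (lt_irrefl _)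
      · left
        refine ⟨⟨hA, hB, hAB, fun X hX => hn X (Or.inr hX)⟩, ?_⟩
        rintro ⟨rfl, rfl⟩
        exact hn J (Or.inl rfl) ⟨hIJ, hJK⟩
  · rintro (⟨⟨hA, hB, hAB, hn⟩, hne⟩ | ⟨rfl, rfl⟩ | ⟨rfl, rfl⟩)
    · refine ⟨Or.inr hA, Or.inr hB, hAB, ?_⟩
      rintro X (rfl | hX) ⟨h1, h2⟩
      · rcases cmp A hA with a | a
        · rcases cmp B hB with b | b
          · exact absurd (h2.trans_le b) hIJ.asymm
          · apply hne
            constructor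
            · by_contra e
              exact hn I hI ⟨lt_of_le_of_ne a e, hIK.trans_le b⟩
            · by_contra e
              exact hn K hK ⟨a.trans_lt hIK, lt_of_le_of_ne b fun e' => e e'.symm⟩
        · exact absurd (h1.trans (hJK.trans_le a)) (lt_irrefl _)
      · exact hn X hX ⟨h1, h2⟩
    · refine ⟨Or.inr hI, Or.inl rfl, hIJ, ?_⟩
      rintro X (rfl | hX) ⟨h1, h2⟩
      · exact absurd h2 (lt_irrefl _)
      · exact hno X hX ⟨h1, h2.trans hJK⟩
    · refine ⟨Or.inl rfl, Or.inr hK, hJK, ?_⟩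
      rintro X (rfl | hX) ⟨h1, h2⟩
      · exact absurd h1 (lt_irrefl _)
      · exact hno X hX ⟨hIJ.trans h1, h2⟩

/-- A condensation raises the dimension by one. -/
theorem IsCondensation.dim_eq [Finite P] {L L' : AdmChain lam} {I K J : LowerSet P}
    (h : IsCondensation L I K J L') : L'.dim = L.dim + 1 := by
  classical
  have hstep := h.isStep_iff
  obtain ⟨hs, hIJ, hJK, -⟩ := h
  have hgap : gap I K = gap I J ∪ gap J K := by
    ext p
    have h1 : p ∈ I → p ∈ J := fun hp => hIJ.le hp
    have h2 : p ∈ J → p ∈ K := fun hp => hJK.le hp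
    simp only [gap, Set.mem_sdiff, SetLike.mem_coe, Set.mem_union]
    tauto
  have hJL : ∀ X, ¬ L.1.IsStep X J := fun X hX => hs.2.2.2 J hX.2.1 ⟨hIJ, hJK⟩
  have hJL' : ∀ X, ¬ L.1.IsStep J X := fun X hX => hs.2.2.2 J hX.1 ⟨hIJ, hJK⟩
  set U : Set (LowerSet P × LowerSet P) :=
    {s | L.1.IsStep s.1 s.2 ∧ gap s.1 s.2 ∩ S = ∅} with hU
  have hIJU : (I, J) ∉ U := fun hu => hJL _ hu.1
  have hJKU : (J, K) ∉ U := fun hu => hJL' _ hu.1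
  have hone : gap I J ∩ S = ∅ ∨ gap J K ∩ S = ∅ := by
    by_contra! hc
    obtain ⟨⟨a, ha, haS⟩, ⟨b, hb, hbS⟩⟩ := hc
    have hlt : lam ⟨a, haS⟩ < lam ⟨b, hbS⟩ :=
      L'.2.2 I J J K ((hstep I J).2 (by simp)) ((hstep J K).2 (by simp)) le_rfl _
        ⟨⟨a, haS⟩, ha, rfl⟩ _ ⟨⟨b, hbS⟩, hb, rfl⟩
    have ma : lam ⟨a, haS⟩ ∈ labels lam I K :=
      ⟨⟨a, haS⟩, show a ∈ gap I K by rw [hgap]; exact Or.inl ha, rfl⟩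
    have mb : lam ⟨b, hbS⟩ ∈ labels lam I K :=
      ⟨⟨b, hbS⟩, show b ∈ gap I K by rw [hgap]; exact Or.inr hb, rfl⟩
    rcases L.2.1 I K hs with h0 | ⟨t, h0⟩
    · rw [h0] at ma; exact ma
    · rw [h0] at ma mb
      rw [Set.mem_singleton_iff] at ma mb
      exact hlt.ne (ma.trans mb.symm)
  have hIKU : (I, K) ∈ U ↔ gap I J ∩ S = ∅ ∧ gap J K ∩ S = ∅ := by
    simp only [hU, Set.mem_ofPred_eq, hs, true_and, hgap, Set.union_inter_distrib_right,
      Set.union_empty_iff]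
  have hdim : L'.dim = {s : LowerSet P × LowerSet P |
      (s ∈ U ∧ s ≠ (I, K)) ∨ (s = (I, J) ∧ gap I J ∩ S = ∅) ∨
        (s = (J, K) ∧ gap J K ∩ S = ∅)}.ncard := by
    unfold AdmChain.dim
    congr 1
    ext ⟨A, B⟩
    simp only [Set.mem_ofPred_eq, hstep A B, hU]
    constructor
    · rintro ⟨⟨h1, h2⟩ | h1 | h1, h3⟩
      · exact Or.inl ⟨⟨h1, h3⟩, h2⟩
      · cases h1; exact Or.inr (Or.inl ⟨rfl, h3⟩)
      · cases h1; exact Or.inr (Or.inr ⟨rfl, h3⟩)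
    · rintro (⟨⟨h1, h3⟩, h2⟩ | ⟨h1, h3⟩ | ⟨h1, h3⟩)
      · exact ⟨Or.inl ⟨h1, h2⟩, h3⟩
      · cases h1; exact ⟨Or.inr (Or.inl rfl), h3⟩
      · cases h1; exact ⟨Or.inr (Or.inr rfl), h3⟩
  have hfin : ∀ V : Set (LowerSet P × LowerSet P), V.Finite := fun V => Set.toFinite V
  rw [hdim]
  change _ = U.ncard + 1
  by_cases h1 : gap I J ∩ S = ∅ <;> by_cases h2 : gap J K ∩ S = ∅
  · have hm : (I, K) ∈ U := hIKU.2 ⟨h1, h2⟩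
    have : {s : LowerSet P × LowerSet P | (s ∈ U ∧ s ≠ (I, K)) ∨ (s = (I, J) ∧ gap I J ∩ S = ∅) ∨
        (s = (J, K) ∧ gap J K ∩ S = ∅)} = insert (I, J) (insert (J, K) (U \ {(I, K)})) := by
      ext s
      simp only [h1, h2, Set.mem_ofPred_eq, Set.mem_insert_iff, Set.mem_sdiff,
        Set.mem_singleton_iff]
      tauto
    rw [this, Set.ncard_insert_of_notMem _ (hfin _), Set.ncard_insert_of_notMem _ (hfin _),
      Set.ncard_sdiff_singleton_add_one hm (hfin _)]
    · exact fun hc => hJKU hc.1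
    · rintro (hc | hc)
      · exact hIJ.ne (congrArg Prod.fst hc)
      · exact hIJU hc.1
  · have hm : (I, K) ∉ U := fun hm => h2 (hIKU.1 hm).2
    have : {s : LowerSet P × LowerSet P | (s ∈ U ∧ s ≠ (I, K)) ∨ (s = (I, J) ∧ gap I J ∩ S = ∅) ∨
        (s = (J, K) ∧ gap J K ∩ S = ∅)} = insert (I, J) U := by
      ext s
      have : s ∈ U → s ≠ (I, K) := fun hs e => hm (e ▸ hs)
      simp only [h1, h2, Set.mem_ofPred_eq, Set.mem_insert_iff]
      tauto
    rw [this, Set.ncard_insert_of_notMem hIJU (hfin _)]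
  · have hm : (I, K) ∉ U := fun hm => h1 (hIKU.1 hm).1
    have : {s : LowerSet P × LowerSet P | (s ∈ U ∧ s ≠ (I, K)) ∨ (s = (I, J) ∧ gap I J ∩ S = ∅) ∨
        (s = (J, K) ∧ gap J K ∩ S = ∅)} = insert (J, K) U := by
      ext s
      have : s ∈ U → s ≠ (I, K) := fun hs e => hm (e ▸ hs)
      simp only [h1, h2, Set.mem_ofPred_eq, Set.mem_insert_iff]
      tauto
    rw [this, Set.ncard_insert_of_notMem hJKU (hfin _)]
  · exact absurd hone (by tauto)

variable (lam)

/-- The space `C^n(P, λ)` over `ℤ/2` with basis the `λ`-admissible chains of dimension `n`. -/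
abbrev ChainCochain (n : ℕ) : Type _ :=
  {L : AdmChain lam // L.dim = n} →₀ ZMod 2

theorem dim_of_hasConjugate [Finite P] {n : ℕ} (L : {L : AdmChain lam // L.dim = n})
    (K : LowerSet P) (L' : {L' : AdmChain lam // HasConjugate L.1 K L'}) :
    L'.1.dim = n + 1 := by
  obtain ⟨I, J, h, -⟩ := L'.2
  rw [h.dim_eq, L.2]

open Classical in
/-- The formal sum `Σ_k(L)`, with `K = I_k`, of all `I_k`-condensations of `L` that have an
`I_k`-conjugate. -/
noncomputable def conjugateSum [Finite P] {n : ℕ} (L : {L : AdmChain lam // L.dim = n})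
    (K : LowerSet P) : ChainCochain lam (n + 1) :=
  ∑ L' : {L' : AdmChain lam // HasConjugate L.1 K L'},
    Finsupp.single ⟨L'.1, dim_of_hasConjugate lam L K L'⟩ 1

/-- The differential `δ` on `C^*(P, λ)`: the linear extension of `δ(L) = ∑_k Σ_k(L)`. -/
noncomputable def chainCoboundary [Finite P] (n : ℕ) :
    ChainCochain lam n →ₗ[ZMod 2] ChainCochain lam (n + 1) :=
  Finsupp.linearCombination (ZMod 2) fun L : {L : AdmChain lam // L.dim = n} =>
    ∑ K ∈ L.1.1.ideals, conjugateSum lam L K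

/-- The coboundaries in `C^n(P, λ)`. -/
noncomputable def chainCoboundaries [Finite P] :
    (n : ℕ) → Submodule (ZMod 2) (ChainCochain lam n)
  | 0 => ⊥
  | n + 1 => LinearMap.range (chainCoboundary lam n)

/-- The cohomology `H^n(C^*(P, λ))`: cocycles modulo coboundaries. -/
abbrev ChainCohomology [Finite P] (n : ℕ) : Type _ :=
  LinearMap.ker (chainCoboundary lam n) ⧸
    (chainCoboundaries lam n).submoduleOf (LinearMap.ker (chainCoboundary lam n))

end Chains

end MarkedPoset

/-!
A chain of ideals `L` is the same thing as a strict weak order on `P` that never puts `q` before `p`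
when `p ≤ q` (`IdealChain.Lt`), and it is admissible exactly if this order restricts to the order of the labels
on the marked elements. So every admissible chain is the chain of sublevel sets of a point
`AdmChain.pt L` of the marked order polytope, every point arises in this way, and the cells `F_L`
are the closures of the pieces into which the hyperplanes `x p = x q` cut the polytope. In these
terms `F_L` is a face of `F_{L'}` if and only if `L ⊆ L'` (`AdmChain.isFace_iff`).

The polytope, its faces and the cells `F_L` are all cut out by inequalities `x p ≤ x q`. A face of
such a polyhedron is given by the pairs that are tight on it (`isFace_relPolytope_iff`), and its
relative boundary consists of the points where more pairs are tight
(`mem_intrinsicFrontier_tightFace`). Hence each cell `F_L` is a relative cell of exactly one face,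
its carrier, and two cells have the same carrier if and only if they identify the same comparable
pairs. A condensation `J` of a step `I ⊂ K` keeps the carrier exactly if no element of `J \ I` is
below an element of `K \ J`, which says that `K \ J` can be adjoined first, i.e. that there is
a conjugate. Thus `δ` is the cellular coboundary restricted to pairs of cells with equal carrier
(`extend_chainCoboundary`), which is the differential of the complex of the subdivision. It squares
to zero because between two nested chains whose dimensions differ by two there are exactly two
chains.

For the cohomology it must be shown that the cells carried by a face `A` have the cochain complex
of a ball of dimension `dim A` relative to its boundary. More generally this holds for the cells
with prescribed signs of `x p - x q` for the pairs `(p, q)` in a set `D` (`isBall_region`). If all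
pairs are in `D`, there is only one cell. Otherwise the hyperplane of a further pair either does not
cut the region, or it cuts it into two regions of the same dimension that are glued along a region
of dimension one less, and a diagram chase (`IsBall.glue`) deduces the claim from that for the three
parts. The chase is carried out for the complex augmented by the coefficient sum in top degree,
because this makes the claim an exactness statement. So the cohomology in degree `n` is detected by
the coefficient sums over the cells of the `n`-dimensional faces (`faceSum`), which take arbitrary
values on cocycles.
-/

namespace MarkedPoset

/-! ### The strict weak order of a chain of ideals -/

section ChainOrder

variable {P : Type*} [PartialOrder P]

/-- The strict weak order on `P` given by a chain of ideals: `p` comes before `q` if some ideal of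
the chain contains `p` but not `q`. Its classes are the differences of neighbouring ideals. -/
def IdealChain.Lt (L : IdealChain P) (p q : P) : Prop :=
  ∃ I ∈ L.ideals, p ∈ I ∧ q ∉ I

theorem IdealChain.not_lt_of_le (L : IdealChain P) {p q : P} (h : p ≤ q) : ¬ L.Lt q p :=
  fun ⟨I, _, hq, hp⟩ => hp (I.lower h hq)

theorem IdealChain.IsStep.not_lt {L : IdealChain P} {I J : LowerSet P} (h : L.IsStep I J)
    {p q : P} (hp : p ∈ gap I J) (hq : q ∈ gap I J) : ¬ L.Lt p q := by
  rintro ⟨K, hK, hpK, hqK⟩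
  obtain ⟨hI, hJ, -, hno⟩ := h
  refine hno K hK ⟨?_, ?_⟩
  · rcases L.isChain.total hI hK with h | h
    · exact lt_of_le_of_ne h fun e => hp.2 (e ▸ hpK)
    · exact absurd (h hpK) hp.2
  · rcases L.isChain.total hK hJ with h | h
    · exact lt_of_le_of_ne h fun e => hqK (e ▸ hq.1)
    · exact absurd (h hq.1) hqK

theorem IdealChain.IsStep.lt_of_le {L : IdealChain P} {I J I' J' : LowerSet P}
    (h : L.IsStep I J) (hle : J ≤ I') {p q : P}
    (hp : p ∈ gap I J) (hq : q ∈ gap I' J') : L.Lt p q :=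
  ⟨J, h.2.1, hp.1, fun hqJ => hq.2 (hle hqJ)⟩

theorem IdealChain.IsStep.trichotomy {L : IdealChain P} {I J I' J' : LowerSet P}
    (h : L.IsStep I J) (h' : L.IsStep I' J') : J ≤ I' ∨ J' ≤ I ∨ (I = I' ∧ J = J') := by
  obtain ⟨hI, hJ, hIJ, hno⟩ := h
  obtain ⟨hI', hJ', hIJ', hno'⟩ := h'
  by_contra! hc
  obtain ⟨h1, h2, h3⟩ := hc
  have a1 : I' < J := lt_of_le_of_ne ((L.isChain.total hJ hI').resolve_left h1)
    fun e => h1 e.ge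
  have a2 : I < J' := lt_of_le_of_ne ((L.isChain.total hJ' hI).resolve_left h2)
    fun e => h2 e.ge
  have e : I = I' := by
    rcases L.isChain.total hI hI' with h | h
    · by_contra hne
      exact hno I' hI' ⟨lt_of_le_of_ne h hne, a1⟩
    · by_contra hne
      exact hno' I hI ⟨lt_of_le_of_ne h (Ne.symm hne), a2⟩
  subst e
  refine h3 rfl ?_
  rcases L.isChain.total hJ hJ' with h | h
  · by_contra hne
    exact hno' J hJ ⟨hIJ, lt_of_le_of_ne h hne⟩
  · by_contra hne
    exact hno J' hJ' ⟨hIJ', lt_of_le_of_ne h (Ne.symm hne)⟩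

theorem IdealChain.exists_isStep_of_ne_bot (L : IdealChain P) {J : LowerSet P}
    (hJ : J ∈ L.ideals) (hne : J ≠ ⊥) : ∃ I, L.IsStep I J := by
  classical
  obtain ⟨I, hI⟩ := (L.ideals.filter (· < J)).exists_maximal
    ⟨⊥, Finset.mem_filter.2 ⟨L.bot_mem, bot_lt_iff_ne_bot.2 hne⟩⟩
  have hI1 := Finset.mem_filter.1 hI.1
  exact ⟨I, hI1.1, hJ, hI1.2, fun K hK h =>
    h.1.not_ge (hI.2 (Finset.mem_filter.2 ⟨hK, h.2⟩) h.1.le)⟩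

theorem IdealChain.exists_isStep_mem_gap (L : IdealChain P) (p : P) :
    ∃ I J, L.IsStep I J ∧ p ∈ gap I J := by
  classical
  obtain ⟨J, hJ⟩ := (L.ideals.filter (p ∈ ·)).exists_minimal
    ⟨⊤, Finset.mem_filter.2 ⟨L.top_mem, LowerSet.mem_top⟩⟩
  have hJ1 := Finset.mem_filter.1 hJ.1
  obtain ⟨I, hI⟩ := L.exists_isStep_of_ne_bot hJ1.1
    (by rintro rfl; exact LowerSet.notMem_bot hJ1.2)
  exact ⟨I, J, hI, hJ1.2, fun hp =>
    hI.2.2.1.not_ge (hJ.2 (Finset.mem_filter.2 ⟨hI.1, hp⟩) hI.2.2.1.le)⟩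

theorem IdealChain.IsStep.gap_nonempty {L : IdealChain P} {I J : LowerSet P} (h : L.IsStep I J) :
    (gap I J).Nonempty :=
  Set.sdiff_nonempty.2 fun hle => h.2.2.1.not_ge hle

theorem IdealChain.IsStep.eq_of_not_lt {L : IdealChain P} {I J I' J' : LowerSet P}
    (h : L.IsStep I J) (h' : L.IsStep I' J') {p q : P} (hp : p ∈ gap I J) (hq : q ∈ gap I' J')
    (h1 : ¬ L.Lt p q) (h2 : ¬ L.Lt q p) : I = I' ∧ J = J' := by
  rcases h.trichotomy h' with h3 | h3 | h3
  · exact absurd (h.lt_of_le h3 hp hq) h1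
  · exact absurd (h'.lt_of_le h3 hq hp) h2
  · exact h3

open Classical in
/-- The number of ideals of the chain that do not contain `p`. -/
noncomputable def IdealChain.rank (L : IdealChain P) (p : P) : ℕ :=
  (L.ideals.filter (p ∉ ·)).card

theorem IdealChain.lt_iff_rank (L : IdealChain P) (p q : P) :
    L.Lt p q ↔ L.rank p < L.rank q := by
  classical
  constructor
  · rintro ⟨I, hI, hp, hq⟩
    refine Finset.card_lt_card ⟨fun J hJ => ?_, fun hsub => ?_⟩
    · obtain ⟨hJ, hpJ⟩ := Finset.mem_filter.1 hJ
      refine Finset.mem_filter.2 ⟨hJ, fun hqJ => ?_⟩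
      rcases L.isChain.total hI hJ with h | h
      · exact hpJ (h hp)
      · exact hq (h hqJ)
    · exact (Finset.mem_filter.1 (hsub (Finset.mem_filter.2 ⟨hI, hq⟩))).2 hp
  · intro h
    by_contra hc
    refine h.not_ge (Finset.card_le_card fun J hJ => ?_)
    obtain ⟨hJ, hqJ⟩ := Finset.mem_filter.1 hJ
    exact Finset.mem_filter.2 ⟨hJ, fun hp => hc ⟨J, hJ, hp, hqJ⟩⟩

theorem IdealChain.ideals_subset_iff {L L' : IdealChain P} :
    L.ideals ⊆ L'.ideals ↔ ∀ p q, L.Lt p q → L'.Lt p q := by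
  classical
  refine ⟨fun h p q ⟨I, hI, hpq⟩ => ⟨I, h hI, hpq⟩, fun h I hI => ?_⟩
  by_cases hbot : I = ⊥
  · exact hbot ▸ L'.bot_mem
  obtain ⟨J, hJ⟩ := (L'.ideals.filter (I ≤ ·)).exists_minimal
    ⟨⊤, Finset.mem_filter.2 ⟨L'.top_mem, le_top⟩⟩
  obtain ⟨hJL, hIJ⟩ := Finset.mem_filter.1 hJ.1
  obtain ⟨K, hK⟩ := L'.exists_isStep_of_ne_bot hJL (fun e => hbot (le_bot_iff.1 (e ▸ hIJ)))
  -- `J` is the least ideal of `L'` above `I`, so its predecessor `K` misses some `p ∈ I`.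
  have hIK : ¬ I ≤ K := fun hIK =>
    hK.2.2.1.not_ge (hJ.2 (Finset.mem_filter.2 ⟨hK.1, hIK⟩) hK.2.2.1.le)
  obtain ⟨p, hpI, hpK⟩ := Set.not_subset.1 hIK
  suffices J ≤ I from (le_antisymm this hIJ) ▸ hJL
  intro q hqJ
  by_contra hqI
  have hlt := h p q ⟨I, hI, hpI, hqI⟩
  by_cases hqK : q ∈ K
  · obtain ⟨M, hM, hpM, hqM⟩ := hlt
    rcases L'.isChain.total hK.1 hM with h1 | h1
    · exact hqM (h1 hqK)
    · exact hpK (h1 hpM)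
  · exact hK.not_lt ⟨hIJ hpI, hpK⟩ ⟨hqJ, hqK⟩ hlt

open Classical in
/-- The chain of sublevel sets of a monotone function. -/
noncomputable def IdealChain.ofMonotone [Finite P] (x : P → ℝ) (hx : Monotone x) :
    IdealChain P where
  ideals := insert ⊥ (insert ⊤ ((Set.finite_range fun p =>
    (⟨{r | x r ≤ x p}, fun _ _ h ha => (hx h).trans ha⟩ : LowerSet P)).toFinset))
  bot_mem := by simp
  top_mem := by simp
  isChain := by
    intro I hI J hJ _
    simp only [Finset.coe_insert, Set.Finite.coe_toFinset, Set.mem_insert_iff,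
      Set.mem_range] at hI hJ
    rcases hI with rfl | rfl | ⟨p, rfl⟩
    · exact Or.inl bot_le
    · exact Or.inr le_top
    · rcases hJ with rfl | rfl | ⟨q, rfl⟩
      · exact Or.inr bot_le
      · exact Or.inl le_top
      · rcases le_total (x p) (x q) with h | h
        · exact Or.inl fun r (hr : x r ≤ x p) => (hr.trans h : x r ≤ x q)
        · exact Or.inr fun r (hr : x r ≤ x q) => (hr.trans h : x r ≤ x p)

theorem IdealChain.ofMonotone_lt [Finite P] (x : P → ℝ) (hx : Monotone x) (p q : P) :
    (IdealChain.ofMonotone x hx).Lt p q ↔ x p < x q := by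
  simp only [IdealChain.Lt, IdealChain.ofMonotone, Finset.mem_insert, Set.Finite.mem_toFinset,
    Set.mem_range]
  constructor
  · rintro ⟨I, rfl | rfl | ⟨r, rfl⟩, hp, hq⟩
    · exact absurd hp LowerSet.notMem_bot
    · exact absurd LowerSet.mem_top hq
    · exact lt_of_le_of_lt (show x p ≤ x r from hp) (not_le.1 hq)
  · intro h
    exact ⟨_, Or.inr (Or.inr ⟨p, rfl⟩), (le_refl (x p) : x p ≤ x p), h.not_ge⟩

end ChainOrder

/-- A function with values on some elements that respects a rank can be extended to all elements,
by density of the reals. -/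
theorem exists_extension_of_rank {P : Type*} [Finite P] (r : P → ℕ) (T : Set P) (f : P → ℝ)
    (h : ∀ p ∈ T, ∀ q ∈ T, f p < f q ↔ r p < r q) :
    ∃ x : P → ℝ, (∀ p ∈ T, x p = f p) ∧ ∀ p q, x p < x q ↔ r p < r q := by
  classical
  induction hn : Tᶜ.ncard generalizing T f with
  | zero =>
    have hT : T = Set.univ := by
      rw [Set.ncard_eq_zero, Set.compl_empty_iff] at hn
      exact hn
    subst hT
    exact ⟨f, fun _ _ => rfl, fun p q => h p trivial q trivial⟩
  | succ n ih =>
    obtain ⟨s, hs⟩ : (Tᶜ).Nonempty := Set.nonempty_of_ncard_ne_zero (by omega)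
    have hcard : (insert s T)ᶜ.ncard = n := by
      have : (insert s T)ᶜ = Tᶜ \ {s} := by ext; simp [not_or, and_comm]
      rw [this, Set.ncard_sdiff_singleton_of_mem hs, hn]
      rfl
    obtain ⟨t, ht⟩ : ∃ t : ℝ, ∀ p ∈ T, (f p < t ↔ r p < r s) ∧ (t < f p ↔ r s < r p) := by
      by_cases he : ∃ q ∈ T, r q = r s
      · obtain ⟨q, hq, hqs⟩ := he
        exact ⟨f q, fun p hp => by rw [h p hp q hq, h q hq p hp, hqs]; exact ⟨Iff.rfl, Iff.rfl⟩⟩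
      · push Not at he
        have hfin : ∀ U : Set P, (f '' U).Finite := fun U => (Set.toFinite U).image f
        obtain ⟨t, h1, h2⟩ := Order.exists_between_finsets
          (hfin {p | p ∈ T ∧ r p < r s}).toFinset (hfin {p | p ∈ T ∧ r s < r p}).toFinset (by
            intro x hx y hy
            simp only [Set.Finite.mem_toFinset, Set.mem_image] at hx hy
            obtain ⟨p, ⟨hp, hps⟩, rfl⟩ := hx
            obtain ⟨q, ⟨hq, hqs⟩, rfl⟩ := hy
            exact (h p hp q hq).2 (hps.trans hqs))
        refine ⟨t, fun p hp => ?_⟩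
        rcases lt_or_gt_of_ne (he p hp) with h3 | h3
        · have := h1 (f p) (by simpa using ⟨p, ⟨hp, h3⟩, rfl⟩)
          exact ⟨⟨fun _ => h3, fun _ => this⟩, ⟨fun h => absurd h this.asymm, fun h => by omega⟩⟩
        · have := h2 (f p) (by simpa using ⟨p, ⟨hp, h3⟩, rfl⟩)
          exact ⟨⟨fun h => absurd h this.asymm, fun h => by omega⟩, ⟨fun _ => h3, fun _ => this⟩⟩
    have hne : ∀ p ∈ T, p ≠ s := fun p hp e => hs (e ▸ hp)
    obtain ⟨x, hx, hxr⟩ := ih (insert s T) (Function.update f s t) (by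
      rintro p (rfl | hp) q (rfl | hq)
      · simp
      · simpa [Function.update_of_ne (hne q hq)] using (ht q hq).2
      · simpa [Function.update_of_ne (hne p hp)] using (ht p hp).1
      · simpa [Function.update_of_ne (hne p hp), Function.update_of_ne (hne q hq)]
          using h p hp q hq) hcard
    exact ⟨x, fun p hp => by rw [hx p (Or.inr hp), Function.update_of_ne (hne p hp)], hxr⟩

section Admissible

variable {P : Type*} [PartialOrder P] {S : Set P} {lam : S → ℝ}

/-- Admissibility in terms of the strict weak order: on marked elements it is the order of the
labels. -/
theorem IdealChain.isAdmissible_iff {L : IdealChain P} :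
    L.IsAdmissible lam ↔ ∀ a b : S, L.Lt a b ↔ lam a < lam b := by
  constructor
  · rintro ⟨h1, h2⟩
    have key : ∀ a b : S, L.Lt a b → lam a < lam b := by
      intro a b hab
      obtain ⟨I, J, hIJ, ha⟩ := L.exists_isStep_mem_gap a
      obtain ⟨I', J', hIJ', hb⟩ := L.exists_isStep_mem_gap b
      rcases hIJ.trichotomy hIJ' with h | h | ⟨rfl, rfl⟩
      · exact h2 I J I' J' hIJ hIJ' h _ ⟨a, ha, rfl⟩ _ ⟨b, hb, rfl⟩
      · have := hIJ'.lt_of_le h hb ha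
        rw [L.lt_iff_rank] at this hab
        omega
      · exact absurd hab (hIJ.not_lt ha hb)
    refine fun a b => ⟨key a b, fun hlt => ?_⟩
    by_contra hab
    have hba : ¬ L.Lt b a := fun h => (key b a h).asymm hlt
    obtain ⟨I, J, hIJ, ha⟩ := L.exists_isStep_mem_gap a
    obtain ⟨I', J', hIJ', hb⟩ := L.exists_isStep_mem_gap b
    obtain ⟨rfl, rfl⟩ := hIJ.eq_of_not_lt hIJ' ha hb hab hba
    have ma : lam a ∈ labels lam I J := ⟨a, ha, rfl⟩
    have mb : lam b ∈ labels lam I J := ⟨b, hb, rfl⟩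
    rcases h1 I J hIJ with h0 | ⟨t, h0⟩
    · rw [h0] at ma; exact ma
    · rw [h0, Set.mem_singleton_iff] at ma mb
      exact hlt.ne (ma.trans mb.symm)
  · intro h
    constructor
    · intro I J hIJ
      by_cases he : labels lam I J = ∅
      · exact Or.inl he
      · obtain ⟨t, ht⟩ := Set.nonempty_iff_ne_empty.2 he
        refine Or.inr ⟨t, Set.eq_singleton_iff_unique_mem.2 ⟨ht, ?_⟩⟩
        obtain ⟨a, ha, rfl⟩ := ht
        rintro _ ⟨b, hb, rfl⟩
        have h1 := mt (h a b).2 (hIJ.not_lt ha hb)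
        have h2 := mt (h b a).2 (hIJ.not_lt hb ha)
        exact le_antisymm (not_lt.1 h1) (not_lt.1 h2)
    · rintro I J I' J' hIJ hIJ' hle _ ⟨a, ha, rfl⟩ _ ⟨b, hb, rfl⟩
      exact (h a b).1 (hIJ.lt_of_le hle ha hb)

theorem AdmChain.lt_iff_lam (L : AdmChain lam) (a b : S) : L.1.Lt a b ↔ lam a < lam b :=
  IdealChain.isAdmissible_iff.1 L.2 a b

noncomputable instance : PartialOrder (AdmChain lam) :=
  PartialOrder.lift (fun L => L.1.ideals) fun _ _ h => Subtype.ext (IdealChain.ext h)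

theorem AdmChain.le_def {L L' : AdmChain lam} : L ≤ L' ↔ L.1.ideals ⊆ L'.1.ideals := Iff.rfl

theorem AdmChain.le_iff_lt {L L' : AdmChain lam} :
    L ≤ L' ↔ ∀ p q, L.1.Lt p q → L'.1.Lt p q := IdealChain.ideals_subset_iff

theorem AdmChain.ext_lt {L L' : AdmChain lam} (h : ∀ p q, L.1.Lt p q ↔ L'.1.Lt p q) : L = L' :=
  le_antisymm (AdmChain.le_iff_lt.2 fun p q => (h p q).1)
    (AdmChain.le_iff_lt.2 fun p q => (h p q).2)

theorem AdmChain.exists_pt [Finite P] (L : AdmChain lam) :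
    ∃ x : P → ℝ, (∀ a : S, x a = lam a) ∧ ∀ p q, x p < x q ↔ L.1.Lt p q := by
  classical
  obtain ⟨x, hx, hxr⟩ := exists_extension_of_rank L.1.rank S
    (fun p => if h : p ∈ S then lam ⟨p, h⟩ else 0) (by
      intro p hp q hq
      simp only [hp, hq, dif_pos]
      rw [← L.1.lt_iff_rank, ← L.lt_iff_lam])
  exact ⟨x, fun a => by rw [hx a a.2]; simp, fun p q => by rw [hxr, L.1.lt_iff_rank]⟩

/-- A point in the relative interior of `F_L`: an extension of `λ` whose chain of sublevel sets is
`L`. -/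
noncomputable def AdmChain.pt [Finite P] (L : AdmChain lam) : P → ℝ := L.exists_pt.choose

theorem AdmChain.pt_lam [Finite P] (L : AdmChain lam) (a : S) : L.pt a = lam a :=
  L.exists_pt.choose_spec.1 a

theorem AdmChain.lt_iff [Finite P] (L : AdmChain lam) (p q : P) : L.1.Lt p q ↔ L.pt p < L.pt q :=
  (L.exists_pt.choose_spec.2 p q).symm

theorem AdmChain.pt_mono [Finite P] (L : AdmChain lam) : Monotone L.pt := fun p q h =>
  not_lt.1 ((L.lt_iff q p).not.1 (L.1.not_lt_of_le h))

theorem AdmChain.le_iff [Finite P] {L L' : AdmChain lam} :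
    L ≤ L' ↔ ∀ p q, L.pt p < L.pt q → L'.pt p < L'.pt q := by
  simp only [AdmChain.le_iff_lt, AdmChain.lt_iff]

theorem AdmChain.ext_pt [Finite P] {L L' : AdmChain lam}
    (h : ∀ p q, L.pt p < L.pt q ↔ L'.pt p < L'.pt q) : L = L' :=
  AdmChain.ext_lt fun p q => by rw [L.lt_iff, L'.lt_iff, h]

/-- Every point of the marked order polytope lies in the relative interior of some `F_L`. -/
theorem exists_admChain [Finite P] {x : P → ℝ} (hx : Monotone x) (hS : ∀ a : S, x a = lam a) :
    ∃ L : AdmChain lam, ∀ p q, L.pt p < L.pt q ↔ x p < x q :=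
  let L : AdmChain lam := ⟨IdealChain.ofMonotone x hx, IdealChain.isAdmissible_iff.2 fun a b => by
    rw [IdealChain.ofMonotone_lt, hS, hS]⟩
  ⟨L, fun p q => (L.lt_iff p q).symm.trans (IdealChain.ofMonotone_lt x hx p q)⟩

/-- Membership in `F_L` in terms of the strict weak order of `L`. -/
theorem mem_chainPolytope_iff [Finite P] {L : IdealChain P} {x : P → ℝ} :
    x ∈ chainPolytope lam L ↔
      (∀ a : S, x a = lam a) ∧ ∀ p q, ¬ L.Lt q p → x p ≤ x q := by
  constructor
  · rintro ⟨h0, h1, h2⟩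
    refine ⟨h0, fun p q hqp => ?_⟩
    obtain ⟨I, J, hIJ, hp⟩ := L.exists_isStep_mem_gap p
    obtain ⟨I', J', hIJ', hq⟩ := L.exists_isStep_mem_gap q
    -- Go down from the step of `q` to the step of `p`.
    induction J' using WellFoundedLT.induction generalizing I' q with
    | ind J' ih =>
      rcases hIJ.trichotomy hIJ' with h | h | ⟨rfl, rfl⟩
      · obtain ⟨K, hK⟩ := L.exists_isStep_of_ne_bot hIJ'.1
          (by rintro rfl; exact LowerSet.notMem_bot (h hp.1))
        obtain ⟨s, hs⟩ := hK.gap_nonempty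
        refine (ih I' hIJ'.2.2.1 s ?_ K hK hs).trans (h2 K I' J' hK hIJ' s hs q hq)
        rintro ⟨M, hM, hsM, hpM⟩
        refine hK.2.2.2 M hM ⟨?_, ?_⟩
        · exact lt_of_le_of_ne ((L.isChain.total hK.1 hM).resolve_right fun h => hs.2 (h hsM))
            fun e => hs.2 (e ▸ hsM)
        · exact lt_of_le_of_ne
            ((L.isChain.total hM hIJ'.1).resolve_right fun h' => hpM (h' (h hp.1)))
            fun e => hpM (e ▸ h hp.1)
      · exact absurd (hIJ'.lt_of_le h hq hp) hqp
      · exact (h1 _ _ hIJ p hp q hq).le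
  · rintro ⟨h0, h1⟩
    refine ⟨h0, fun I J hIJ p hp q hq => le_antisymm (h1 p q (hIJ.not_lt hq hp))
      (h1 q p (hIJ.not_lt hp hq)), fun I J K hIJ hJK p hp q hq => h1 p q fun hlt => ?_⟩
    have := hIJ.lt_of_le le_rfl hp hq
    rw [L.lt_iff_rank] at this hlt
    omega

end Admissible

/-! ### Polyhedra defined by comparisons of coordinates -/

section RelPolytope

variable {P : Type*} {S : Set P}

/-- The polyhedron of all extensions `x` of `λ` with `x p ≤ x q` for the pairs `(p, q)` in `D`. -/
def relPolytope (lam : S → ℝ) (D : Set (P × P)) : Set (P → ℝ) :=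
  {x | (∀ a : S, x a = lam a) ∧ ∀ p q, (p, q) ∈ D → x p ≤ x q}

/-- The vectors that vanish on the marked elements and take equal values on the pairs in `E`. -/
def constSub (S : Set P) (E : Set (P × P)) : Submodule ℝ (P → ℝ) where
  carrier := {v | (∀ a : S, v a = 0) ∧ ∀ p q, (p, q) ∈ E → v p = v q}
  add_mem' := by
    rintro v w ⟨h1, h2⟩ ⟨h3, h4⟩
    exact ⟨fun a => by simp [h1, h3], fun p q h => by simp [h2 p q h, h4 p q h]⟩
  zero_mem' := by simp
  smul_mem' := by
    rintro c v ⟨h1, h2⟩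
    exact ⟨fun a => by simp [h1], fun p q h => by simp [h2 p q h]⟩

theorem mem_constSub {E : Set (P × P)} {v : P → ℝ} :
    v ∈ constSub S E ↔ (∀ a : S, v a = 0) ∧ ∀ p q, (p, q) ∈ E → v p = v q := Iff.rfl

theorem constSub_anti {E E' : Set (P × P)} (h : E ⊆ E') : constSub S E' ≤ constSub S E :=
  fun _ hv => ⟨hv.1, fun p q hpq => hv.2 p q (h hpq)⟩

/-- The pairs of `D` on which `z` takes equal values. -/
def tight (D : Set (P × P)) (z : P → ℝ) : Set (P × P) :=
  {s | s ∈ D ∧ z s.1 = z s.2}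

theorem mem_tight {D : Set (P × P)} {z : P → ℝ} {p q : P} :
    (p, q) ∈ tight D z ↔ (p, q) ∈ D ∧ z p = z q := Iff.rfl

/-- The part of a polyhedron on which the pairs that are tight at `z` are tight: the smallest face
containing `z`. -/
def tightFace (lam : S → ℝ) (D : Set (P × P)) (z : P → ℝ) : Set (P → ℝ) :=
  {x | x ∈ relPolytope lam D ∧ ∀ p q, (p, q) ∈ D → z p = z q → x p = x q}

theorem self_mem_tightFace {lam : S → ℝ} {D : Set (P × P)} {z : P → ℝ}
    (hz : z ∈ relPolytope lam D) : z ∈ tightFace lam D z := ⟨hz, fun _ _ _ h => h⟩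

theorem exists_pos_perturbation [Finite P] (x v : P → ℝ) :
    ∃ ε > 0, ∀ p q, x p < x q → x p + ε * v p < x q + ε * v q := by
  have h : ∀ᶠ ε : ℝ in nhdsWithin 0 (Set.Ioi 0),
      ∀ p q, x p < x q → x p + ε * v p < x q + ε * v q := by
    rw [Filter.eventually_all]
    intro p
    rw [Filter.eventually_all]
    intro q
    by_cases hpq : x p < x q
    · have : ∀ᶠ ε : ℝ in nhds 0, x p + ε * v p < x q + ε * v q := by
        refine (isOpen_lt (f := fun ε : ℝ => x p + ε * v p) (g := fun ε : ℝ => x q + ε * v q)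
          (by fun_prop) (by fun_prop)).mem_nhds ?_
        simpa using hpq
      exact (this.filter_mono nhdsWithin_le_nhds).mono fun _ h _ => h
    · exact Filter.Eventually.of_forall fun _ h => absurd h hpq
  obtain ⟨ε, h1, h2⟩ := (h.and self_mem_nhdsWithin).exists
  exact ⟨ε, h2, h1⟩

/-- The functional summing `x p - x q` over a finite set of pairs. -/
noncomputable def pairFunctional [Finite P] (T : Set (P × P)) : StrongDual ℝ (P → ℝ) :=
  ∑ s ∈ (Set.toFinite T).toFinset,
    (ContinuousLinearMap.proj (R := ℝ) (φ := fun _ : P => ℝ) s.1 -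
      ContinuousLinearMap.proj (R := ℝ) (φ := fun _ : P => ℝ) s.2)

theorem pairFunctional_apply [Finite P] (T : Set (P × P)) (x : P → ℝ) :
    pairFunctional T x = ∑ s ∈ (Set.toFinite T).toFinset, (x s.1 - x s.2) := by
  simp [pairFunctional]

theorem isExposed_tight [Finite P] {lam : S → ℝ} {D T : Set (P × P)} (hT : T ⊆ D) :
    IsExposed ℝ (relPolytope lam D)
      {x | x ∈ relPolytope lam D ∧ ∀ p q, (p, q) ∈ T → x p = x q} := by
  rintro ⟨z, hz, hzT⟩
  refine ⟨pairFunctional T, ?_⟩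
  have hle : ∀ x ∈ relPolytope lam D, ∀ s ∈ (Set.toFinite T).toFinset, x s.1 - x s.2 ≤ 0 := by
    intro x hx s hs
    have := hx.2 s.1 s.2 (hT ((Set.toFinite T).mem_toFinset.1 hs))
    linarith
  have h0 : ∀ x : P → ℝ, (∀ p q, (p, q) ∈ T → x p = x q) → pairFunctional T x = 0 := by
    intro x hx
    rw [pairFunctional_apply]
    refine Finset.sum_eq_zero fun s hs => ?_
    rw [hx s.1 s.2 ((Set.toFinite T).mem_toFinset.1 hs), sub_self]
  ext x
  constructor
  · rintro ⟨hx, hxT⟩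
    refine ⟨hx, fun y hy => ?_⟩
    rw [h0 x hxT, pairFunctional_apply]
    exact Finset.sum_nonpos (hle y hy)
  · rintro ⟨hx, hmax⟩
    refine ⟨hx, fun p q hpq => ?_⟩
    have h1 := hmax z hz
    rw [h0 z hzT, pairFunctional_apply] at h1
    have h2 := (Finset.sum_eq_zero_iff_of_nonpos (hle x hx)).1
      (le_antisymm (Finset.sum_nonpos (hle x hx)) h1) (p, q) ((Set.toFinite T).mem_toFinset.2 hpq)
    exact sub_eq_zero.1 h2

theorem isFace_tightFace [Finite P] {lam : S → ℝ} {D : Set (P × P)} {z : P → ℝ}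
    (hz : z ∈ relPolytope lam D) : IsFace (relPolytope lam D) (tightFace lam D z) := by
  refine ⟨⟨z, self_mem_tightFace hz⟩, ?_⟩
  have h : tightFace lam D z =
      {x | x ∈ relPolytope lam D ∧ ∀ p q, (p, q) ∈ tight D z → x p = x q} := by
    ext x
    simp only [tightFace, tight, Set.mem_ofPred_eq, and_imp]
  rw [h]
  exact isExposed_tight fun _ h => h.1

theorem convex_relPolytope (lam : S → ℝ) (D : Set (P × P)) : Convex ℝ (relPolytope lam D) := by
  rintro x ⟨hx, hx'⟩ y ⟨hy, hy'⟩ a b ha hb hab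
  refine ⟨fun s => ?_, fun p q h => ?_⟩
  · simp only [Pi.add_apply, Pi.smul_apply, smul_eq_mul, hx, hy]
    rw [← add_mul, hab, one_mul]
  · simp only [Pi.add_apply, Pi.smul_apply, smul_eq_mul]
    exact add_le_add (mul_le_mul_of_nonneg_left (hx' p q h) ha)
      (mul_le_mul_of_nonneg_left (hy' p q h) hb)

/-- A nonempty convex part of a polyhedron contains a point at which as few pairs as possible are
tight. -/
theorem exists_generic [Finite P] {lam : S → ℝ} {D : Set (P × P)} {A : Set (P → ℝ)}
    (hA : A ⊆ relPolytope lam D) (hconv : Convex ℝ A) (hne : A.Nonempty) :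
    ∃ z ∈ A, ∀ x ∈ A, tight D z ⊆ tight D x := by
  obtain ⟨z, hz, hmin⟩ := exists_minimalFor_of_wellFoundedLT (fun z => z ∈ A)
    (fun z => tight D z) hne
  refine ⟨z, hz, fun x hx => ?_⟩
  -- At the midpoint of `z` and `x` exactly the pairs that are tight at both are tight.
  set m : P → ℝ := (1 / 2 : ℝ) • z + (1 / 2 : ℝ) • x with hm
  have hmA : m ∈ A := hconv hz hx (by norm_num) (by norm_num) (by norm_num)
  have hsub : ∀ p q, (p, q) ∈ tight D m → z p = z q ∧ x p = x q := by
    rintro p q ⟨hD, h⟩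
    have h1 := (hA hz).2 p q hD
    have h2 := (hA hx).2 p q hD
    simp only [hm, Pi.add_apply, Pi.smul_apply, smul_eq_mul] at h
    constructor <;> linarith
  have h1 : tight D m ⊆ tight D z := fun s hs => ⟨hs.1, (hsub s.1 s.2 hs).1⟩
  exact fun s hs => ⟨hs.1, (hsub s.1 s.2 (hmin hmA h1 hs)).2⟩

/-- A small perturbation of a point along a direction that keeps the tight pairs tight stays in the
polyhedron. -/
theorem exists_add_mem [Finite P] {lam : S → ℝ} {D : Set (P × P)} {z v : P → ℝ}
    (hz : z ∈ relPolytope lam D) (hv : v ∈ constSub S (tight D z)) :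
    ∃ ε : ℝ, 0 < ε ∧ z + ε • v ∈ tightFace lam D z := by
  obtain ⟨ε, hε, h⟩ := exists_pos_perturbation z v
  have heq : ∀ p q, (p, q) ∈ D → z p = z q → (z + ε • v) p = (z + ε • v) q := by
    intro p q hD he
    simp [he, hv.2 p q ⟨hD, he⟩]
  refine ⟨ε, hε, ⟨⟨fun a => by simp [hz.1, hv.1], fun p q hD => ?_⟩, heq⟩⟩
  rcases (hz.2 p q hD).lt_or_eq with h1 | h1
  · exact (h p q h1).le
  · exact (heq p q hD h1).le

/-- The faces of the polyhedron are given by sets of tight pairs. -/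
theorem isFace_relPolytope_iff [Finite P] {lam : S → ℝ} {D : Set (P × P)} {A : Set (P → ℝ)} :
    IsFace (relPolytope lam D) A ↔ ∃ z ∈ relPolytope lam D, A = tightFace lam D z := by
  constructor
  · rintro ⟨hne, hexp⟩
    obtain ⟨z, hz, hmin⟩ := exists_generic hexp.subset (hexp.convex (convex_relPolytope lam D)) hne
    refine ⟨z, hexp.subset hz, Set.Subset.antisymm (fun x hx => ?_) fun y hy => ?_⟩
    · exact ⟨hexp.subset hx, fun p q hD h => (hmin x hx ⟨hD, h⟩).2⟩
    · obtain ⟨l, rfl⟩ := hexp hne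
      refine ⟨hy.1, fun w hw => (hz.2 w hw).trans ?_⟩
      -- The segment from `y` to `z` can be prolonged beyond `z` inside the polyhedron.
      obtain ⟨ε, hε, hmem⟩ := exists_add_mem (v := z - y) hz.1
        ⟨fun a => by simp [hz.1.1, hy.1.1], fun p q h => by
          simp [mem_tight.1 h |>.2, hy.2 p q h.1 h.2]⟩
      have := hz.2 _ hmem.1
      rw [map_add, map_smul, map_sub, smul_eq_mul] at this
      have : ε * (l z - l y) ≤ 0 := by linarith
      have := nonpos_of_mul_nonpos_right this hε
      linarith
  · rintro ⟨z, hz, rfl⟩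
    exact isFace_tightFace hz

/-- The direction of the affine span of a set that is a neighbourhood of one of its points in
a translate of `W`. -/
theorem direction_affineSpan_eq {E : Type*} [AddCommGroup E] [Module ℝ E] {A : Set E}
    {W : Submodule ℝ E} {z : E} (hz : z ∈ A) (h1 : ∀ x ∈ A, x - z ∈ W)
    (h2 : ∀ v ∈ W, ∃ ε : ℝ, 0 < ε ∧ z + ε • v ∈ A) : (affineSpan ℝ A).direction = W := by
  rw [direction_affineSpan]
  apply le_antisymm
  · rw [vectorSpan_eq_span_vsub_set_right ℝ hz, Submodule.span_le]
    rintro _ ⟨x, hx, rfl⟩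
    exact h1 x hx
  · intro v hv
    obtain ⟨ε, hε, h⟩ := h2 v hv
    have h3 := vsub_mem_vectorSpan ℝ h hz
    rw [vsub_eq_sub, add_sub_cancel_left] at h3
    have := (vectorSpan ℝ A).smul_mem ε⁻¹ h3
    rwa [smul_smul, inv_mul_cancel₀ hε.ne', one_smul] at this

theorem direction_tightFace [Finite P] {lam : S → ℝ} {D : Set (P × P)} {z : P → ℝ}
    (hz : z ∈ relPolytope lam D) :
    (affineSpan ℝ (tightFace lam D z)).direction = constSub S (tight D z) :=
  direction_affineSpan_eq (self_mem_tightFace hz)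
    (fun x hx => ⟨fun a => by simp [hx.1.1, hz.1], fun p q h => by
      simp [hx.2 p q h.1 h.2, mem_tight.1 h |>.2]⟩)
    fun _ hv => exists_add_mem hz hv

theorem polyDim_tightFace [Finite P] {lam : S → ℝ} {D : Set (P × P)} {z : P → ℝ}
    (hz : z ∈ relPolytope lam D) :
    polyDim (tightFace lam D z) = Module.finrank ℝ (constSub S (tight D z)) := by
  rw [polyDim, direction_tightFace hz]

theorem sub_mem_of_mem_affineSpan [Finite P] {lam : S → ℝ} {D : Set (P × P)} {z x : P → ℝ}
    (hz : z ∈ relPolytope lam D) (hx : x ∈ affineSpan ℝ (tightFace lam D z)) :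
    x - z ∈ constSub S (tight D z) := by
  rw [← direction_tightFace hz]
  exact AffineSubspace.vsub_mem_direction hx (subset_affineSpan ℝ _ (self_mem_tightFace hz))

/-- A point of a face lies in the relative boundary if and only if an additional pair is tight. -/
theorem mem_intrinsicFrontier_tightFace [Finite P] {lam : S → ℝ} {D : Set (P × P)} {z y : P → ℝ}
    (hz : z ∈ relPolytope lam D) (hy : y ∈ tightFace lam D z) :
    y ∈ intrinsicFrontier ℝ (tightFace lam D z) ↔ ∃ p q, (p, q) ∈ D ∧ y p = y q ∧ z p ≠ z q := by
  set A := tightFace lam D z with hA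
  have hyspan : y ∈ affineSpan ℝ A := subset_affineSpan ℝ _ hy
  have hcl : IsClosed A := by
    have : A = ((⋂ a : S, {x : P → ℝ | x a = lam a}) ∩
        (⋂ s ∈ D, {x : P → ℝ | x s.1 ≤ x s.2})) ∩
        ⋂ s ∈ tight D z, {x : P → ℝ | x s.1 = x s.2} := by
      ext x
      simp only [hA, tightFace, relPolytope, tight, Set.mem_inter_iff, Set.mem_iInter,
        Set.mem_ofPred_eq, Prod.forall, and_imp]
    rw [this]
    refine ((isClosed_iInter fun a => isClosed_eq (by fun_prop) (by fun_prop)).inter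
      (isClosed_biInter fun s _ => isClosed_le (by fun_prop) (by fun_prop))).inter
      (isClosed_biInter fun s _ => isClosed_eq (by fun_prop) (by fun_prop))
  have hcl' : IsClosed ((↑) ⁻¹' A : Set (affineSpan ℝ A)) := hcl.preimage continuous_subtype_val
  rw [intrinsicFrontier, hcl'.frontier_eq]
  have hiff : y ∈ ((↑) '' (((↑) ⁻¹' A : Set (affineSpan ℝ A)) \ interior ((↑) ⁻¹' A)) :
      Set (P → ℝ)) ↔ (⟨y, hyspan⟩ : affineSpan ℝ A) ∉ interior ((↑) ⁻¹' A : Set (affineSpan ℝ A)) := by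
    constructor
    · rintro ⟨⟨w, hw⟩, h, rfl⟩
      exact h.2
    · exact fun h => ⟨⟨y, hyspan⟩, ⟨hy, h⟩, rfl⟩
  rw [hiff]
  constructor
  · intro h
    by_contra! hc
    refine h (mem_interior.2 ⟨{w | ∀ s : P × P, y s.1 < y s.2 → (w : P → ℝ) s.1 < (w : P → ℝ) s.2},
      ?_, ?_, fun s hs => hs⟩)
    · rintro ⟨w, hw⟩ hlt
      have hwz := sub_mem_of_mem_affineSpan hz hw
      have heq : ∀ p q, (p, q) ∈ D → z p = z q → w p = w q := by
        intro p q hD h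
        have := hwz.2 p q ⟨hD, h⟩
        simp only [Pi.sub_apply] at this
        linarith
      refine ⟨⟨fun a => ?_, fun p q hD => ?_⟩, heq⟩
      · have := hwz.1 a
        simp only [Pi.sub_apply, hz.1] at this
        linarith
      · rcases (hy.1.2 p q hD).lt_or_eq with h1 | h1
        · exact (hlt (p, q) h1).le
        · exact (heq p q hD (hc p q hD h1)).le
    · have : {w : affineSpan ℝ A | ∀ s : P × P, y s.1 < y s.2 →
          (w : P → ℝ) s.1 < (w : P → ℝ) s.2} =
          ⋂ s ∈ {s : P × P | y s.1 < y s.2},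
            {w : affineSpan ℝ A | (w : P → ℝ) s.1 < (w : P → ℝ) s.2} := by
        ext w
        simp
      rw [this]
      refine (Set.toFinite _).isOpen_biInter fun s _ => isOpen_lt ?_ ?_
      · exact (continuous_apply s.1).comp continuous_subtype_val
      · exact (continuous_apply s.2).comp continuous_subtype_val
  · rintro ⟨p, q, hD, hypq, hzpq⟩ hint
    have hzlt : z p < z q := lt_of_le_of_ne (hz.2 p q hD) hzpq
    have hzspan : z ∈ affineSpan ℝ A := subset_affineSpan ℝ _ (self_mem_tightFace hz)
    -- Moving from `y` away from `z` leaves the face at once.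
    let g : ℝ → affineSpan ℝ A := fun t => ⟨AffineMap.lineMap y z t,
      AffineMap.lineMap_mem t hyspan hzspan⟩
    have hg : Continuous g := by
      refine Continuous.subtype_mk ?_ _
      exact AffineMap.lineMap_continuous
    have hg0 : g 0 = ⟨y, hyspan⟩ := Subtype.ext (AffineMap.lineMap_apply_zero y z)
    have hev : ∀ᶠ t in nhds (0 : ℝ), g t ∈ interior ((↑) ⁻¹' A : Set (affineSpan ℝ A)) :=
      hg.continuousAt.eventually (by rw [hg0]; exact isOpen_interior.mem_nhds hint)
    have hev' := hev.filter_mono (nhdsWithin_le_nhds (s := Set.Iio 0))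
    obtain ⟨t, ht, ht0⟩ := (hev'.and self_mem_nhdsWithin).exists
    have hmem' : g t ∈ ((↑) ⁻¹' A : Set (affineSpan ℝ A)) := interior_subset ht
    have hmem : (g t : P → ℝ) ∈ A := hmem'
    have h1 := hmem.1.2 p q hD
    simp only [g, AffineMap.lineMap_apply, vsub_eq_sub, vadd_eq_add, Pi.add_apply, Pi.smul_apply,
      Pi.sub_apply, smul_eq_mul] at h1
    have ht0 : t < 0 := ht0
    nlinarith

end RelPolytope

/-! ### Balls cut by a hyperplane: acyclicity of the augmented cochain complex -/

section Ball

open Matrix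

variable {ι : Type*} [Fintype ι]

/-- The set `X` of cells, with mod 2 incidence matrix `inc` and dimension function `dim`, has the
cochain complex of a `d`-dimensional ball relative to its boundary: the complex of cochains
supported on `X`, augmented in degree `d` by the sum of all coefficients, is exact. A cochain is a
function on all cells, and its coboundary in `X` is the restriction of `z ᵥ* inc` to `X`. -/
structure IsBall (inc : Matrix ι ι (ZMod 2)) (dim : ι → ℕ) (X : Set ι) (d : ℕ) : Prop where
  dim_le : ∀ σ ∈ X, dim σ ≤ d
  exists_top : ∃ σ ∈ X, dim σ = d
  even : ∀ σ ∈ X, dim σ + 1 = d → ∑ τ, X.indicator (inc σ) τ = 0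
  exact : ∀ (n : ℕ) (z : ι → ZMod 2), (∀ σ, z σ ≠ 0 → σ ∈ X ∧ dim σ = n) →
    (∀ τ ∈ X, (z ᵥ* inc) τ = 0) → (n = d → ∑ σ, z σ = 0) →
    ∃ w : ι → ZMod 2, (∀ σ, w σ ≠ 0 → σ ∈ X ∧ dim σ + 1 = n) ∧ ∀ τ ∈ X, (w ᵥ* inc) τ = z τ

variable {inc : Matrix ι ι (ZMod 2)} {dim : ι → ℕ}

theorem isBall_singleton (σ : ι) :
    IsBall inc dim {σ} (dim σ) where
  dim_le := by simp
  exists_top := by simp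
  even := by
    intro τ hτ h
    rw [Set.mem_singleton_iff] at hτ
    subst hτ
    omega
  exact := by
    classical
    intro n z hz _ hsum
    refine ⟨0, by simp, ?_⟩
    rintro τ rfl
    rw [zero_vecMul]
    by_contra hne
    have h := hz τ (Ne.symm hne)
    have h1 := hsum h.2.symm
    rw [Finset.sum_eq_single τ (fun σ _ hσ => by
      by_contra h'
      exact hσ (hz σ h').1) (by simp)] at h1
    exact hne h1.symm

theorem sum_indicator_vecMul (Y : Set ι) (z : ι → ZMod 2) :
    ∑ τ, Y.indicator (z ᵥ* inc) τ = ∑ σ, z σ * ∑ τ, Y.indicator (inc σ) τ := by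
  classical
  simp only [Finset.mul_sum]
  rw [Finset.sum_comm]
  refine Finset.sum_congr rfl fun τ _ => ?_
  by_cases h : τ ∈ Y
  · simp [h, vecMul, dotProduct]
  · simp [h]

theorem vecMul_apply_eq_zero {z : ι → ZMod 2} {τ : ι} (h : ∀ σ, z σ ≠ 0 → inc σ τ = 0) :
    (z ᵥ* inc) τ = 0 := by
  refine Finset.sum_eq_zero fun σ _ => ?_
  by_cases hz : z σ = 0
  · rw [hz, zero_mul]
  · exact mul_eq_zero_of_right _ (h σ hz)

/-- Exactness on an open part `Y`, for a cochain whose coboundary on `Y` only involves its values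
on `Y`. -/
theorem IsBall.exact_part {X Y : Set ι} {d : ℕ} (b : IsBall inc dim Y d) (hYX : Y ⊆ X)
    (hup : ∀ σ ∈ Y, ∀ τ ∈ X, inc σ τ ≠ 0 → τ ∈ Y) {n : ℕ} {z : ι → ZMod 2}
    (hz : ∀ σ, z σ ≠ 0 → dim σ = n) (hzY : ∀ σ, z σ ≠ 0 → σ ∉ Y → ∀ τ ∈ Y, inc σ τ = 0)
    (hc : ∀ τ ∈ X, (z ᵥ* inc) τ = 0) (hsum : n = d → ∑ σ, Y.indicator z σ = 0) :
    ∃ w : ι → ZMod 2, (∀ σ, w σ ≠ 0 → σ ∈ Y ∧ dim σ + 1 = n) ∧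
      ∀ τ ∈ X, (w ᵥ* inc) τ = Y.indicator z τ := by
  classical
  obtain ⟨w, hw, hwz⟩ := b.exact n (Y.indicator z) (fun σ h => by
      have hσ : σ ∈ Y := Set.mem_of_indicator_ne_zero h
      exact ⟨hσ, hz σ (by rwa [Set.indicator_of_mem hσ] at h)⟩) (fun τ hτ => by
      rw [← hc τ (hYX hτ), ← sub_eq_zero, ← Pi.sub_apply, ← sub_vecMul]
      refine vecMul_apply_eq_zero fun σ hσ => ?_
      by_cases hY : σ ∈ Y
      · simp [hY] at hσ
      · exact hzY σ (by simpa [hY] using hσ) hY τ hτ) hsum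
  refine ⟨w, hw, fun τ hτ => ?_⟩
  by_cases hY : τ ∈ Y
  · exact hwz τ hY
  · rw [Set.indicator_of_notMem hY]
    refine vecMul_apply_eq_zero fun σ hσ => ?_
    by_contra h
    exact hY (hup σ (hw σ hσ).1 τ hτ h)

/-- A ball `X` of dimension `d` is glued from two balls `Y`, `Z` of dimension `d` along a ball `X₀`
of dimension `d - 1`. -/
theorem IsBall.glue (hinc : ∀ σ τ, inc σ τ ≠ 0 → dim τ = dim σ + 1) (hsq : inc * inc = 0)
    {X Y X₀ Z : Set ι} {d d₀ : ℕ} (hd : d₀ + 1 = d)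
    (hX : ∀ σ, σ ∈ X ↔ σ ∈ Y ∨ σ ∈ X₀ ∨ σ ∈ Z)
    (hY₀ : Disjoint Y X₀) (hYZ : Disjoint Y Z) (hZ₀ : Disjoint Z X₀)
    (hYup : ∀ σ ∈ Y, ∀ τ ∈ X, inc σ τ ≠ 0 → τ ∈ Y)
    (hZup : ∀ σ ∈ Z, ∀ τ ∈ X, inc σ τ ≠ 0 → τ ∈ Z)
    (hconv : ∀ σ ∈ X, ∀ τ ∈ X, ∀ ρ, inc σ ρ ≠ 0 → inc ρ τ ≠ 0 → ρ ∈ X)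
    (hY : ∀ σ ∈ X₀, dim σ + 1 = d → ∑ τ, Y.indicator (inc σ) τ = 1)
    (hZ : ∀ σ ∈ X₀, dim σ + 1 = d → ∑ τ, Z.indicator (inc σ) τ = 1)
    (bY : IsBall inc dim Y d) (b₀ : IsBall inc dim X₀ d₀) (bZ : IsBall inc dim Z d) :
    IsBall inc dim X d := by
  classical
  have hYX : Y ⊆ X := fun σ h => (hX σ).2 (Or.inl h)
  have h₀X : X₀ ⊆ X := fun σ h => (hX σ).2 (Or.inr (Or.inl h))
  have hZX : Z ⊆ X := fun σ h => (hX σ).2 (Or.inr (Or.inr h))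
  have dY₀ : ∀ σ ∈ Y, σ ∉ X₀ := fun σ h h' => Set.disjoint_left.1 hY₀ h h'
  have dYZ : ∀ σ ∈ Y, σ ∉ Z := fun σ h h' => Set.disjoint_left.1 hYZ h h'
  have dZ₀ : ∀ σ ∈ Z, σ ∉ X₀ := fun σ h h' => Set.disjoint_left.1 hZ₀ h h'
  have split : ∀ z : ι → ZMod 2, X.indicator z =
      Y.indicator z + X₀.indicator z + Z.indicator z := by
    intro z
    funext σ
    simp only [Pi.add_apply]
    by_cases h1 : σ ∈ Y
    · simp [h1, hYX h1, dY₀ σ h1, dYZ σ h1]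
    by_cases h2 : σ ∈ X₀
    · have h3 : σ ∉ Z := fun h => dZ₀ σ h h2
      simp [h1, h2, h3, h₀X h2]
    by_cases h3 : σ ∈ Z
    · simp [h1, h2, h3, hZX h3]
    · have : σ ∉ X := fun h => by
        rcases (hX σ).1 h with h | h | h
        exacts [h1 h, h2 h, h3 h]
      simp [h1, h2, h3, this]
  have splitsum : ∀ z : ι → ZMod 2, ∑ σ, X.indicator z σ =
      ∑ σ, Y.indicator z σ + ∑ σ, X₀.indicator z σ + ∑ σ, Z.indicator z σ := by
    intro z
    rw [split z]
    simp only [Pi.add_apply, Finset.sum_add_distrib]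
  refine ⟨?_, ?_, ?_, ?_⟩
  · intro σ hσ
    rcases (hX σ).1 hσ with h | h | h
    · exact bY.dim_le σ h
    · exact (b₀.dim_le σ h).trans (by omega)
    · exact bZ.dim_le σ h
  · obtain ⟨σ, h1, h2⟩ := bY.exists_top
    exact ⟨σ, hYX h1, h2⟩
  · intro σ hσ hdim
    have zero : ∀ W : Set ι, (∀ τ ∈ W, inc σ τ = 0) → ∑ τ, W.indicator (inc σ) τ = 0 := by
      intro W hW
      refine Finset.sum_eq_zero fun τ _ => ?_
      by_cases h : τ ∈ W
      · rw [Set.indicator_of_mem h, hW τ h]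
      · rw [Set.indicator_of_notMem h]
    rw [splitsum]
    rcases (hX σ).1 hσ with h | h | h
    · rw [bY.even σ h hdim, zero X₀, zero Z]
      · simp
      · intro τ hτ
        by_contra hne
        exact dYZ τ (hYup σ h τ (hZX hτ) hne) hτ
      · intro τ hτ
        by_contra hne
        exact dY₀ τ (hYup σ h τ (h₀X hτ) hne) hτ
    · rw [hY σ h hdim, hZ σ h hdim, zero X₀]
      · decide
      · intro τ hτ
        by_contra hne
        have := hinc σ τ hne
        have := b₀.dim_le τ hτ
        omega
    · rw [bZ.even σ h hdim, zero X₀, zero Y]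
      · simp
      · intro τ hτ
        by_contra hne
        exact dYZ τ hτ (hZup σ h τ (hYX hτ) hne)
      · intro τ hτ
        by_contra hne
        exact dZ₀ τ (hZup σ h τ (h₀X hτ) hne) hτ
  intro n z hz hcz hsum
  have hzX : X.indicator z = z := by
    rw [Set.indicator_eq_self]
    exact fun σ hσ => (hz σ hσ).1
  -- Only the values of `z` on `X₀` matter for its coboundary on `X₀`.
  have hc₀ : ∀ τ ∈ X₀, (X₀.indicator z ᵥ* inc) τ = 0 := by
    intro τ hτ
    rw [← hcz τ (h₀X hτ), ← sub_eq_zero, ← Pi.sub_apply, ← sub_vecMul]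
    refine vecMul_apply_eq_zero fun σ hσ => ?_
    by_contra hne
    by_cases h₀ : σ ∈ X₀
    · simp [h₀] at hσ
    have hzσ : z σ ≠ 0 := by simpa [h₀] using hσ
    rcases (hX σ).1 (hz σ hzσ).1 with h | h | h
    · exact dY₀ τ (hYup σ h τ (h₀X hτ) hne) hτ
    · exact h₀ h
    · exact dZ₀ τ (hZup σ h τ (h₀X hτ) hne) hτ
  -- The restriction of `z` to `X₀` has coefficient sum zero in degree `d₀`: sum `δz` over `Y`.
  have hsum₀ : n = d₀ → ∑ σ, X₀.indicator z σ = 0 := by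
    intro hn
    have h1 : ∑ τ, Y.indicator (z ᵥ* inc) τ = 0 := by
      refine Finset.sum_eq_zero fun τ _ => ?_
      by_cases h : τ ∈ Y
      · rw [Set.indicator_of_mem h, hcz τ (hYX h)]
      · rw [Set.indicator_of_notMem h]
    rw [sum_indicator_vecMul] at h1
    rw [← h1]
    refine Finset.sum_congr rfl fun σ _ => ?_
    by_cases hzσ : z σ = 0
    · simp [Set.indicator, hzσ]
    obtain ⟨hσX, hσn⟩ := hz σ hzσ
    rcases (hX σ).1 hσX with h | h | h
    · rw [Set.indicator_of_notMem (dY₀ σ h), bY.even σ h (by omega), mul_zero]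
    · rw [Set.indicator_of_mem h, hY σ h (by omega), mul_one]
    · rw [Set.indicator_of_notMem (dZ₀ σ h)]
      rw [Finset.sum_eq_zero, mul_zero]
      intro τ _
      by_cases hτ : τ ∈ Y
      · rw [Set.indicator_of_mem hτ]
        by_contra hne
        exact dYZ τ hτ (hZup σ h τ (hYX hτ) hne)
      · rw [Set.indicator_of_notMem hτ]
  obtain ⟨w₀, hw₀, hwz₀⟩ := b₀.exact n (X₀.indicator z) (fun σ h => by
    have hσ : σ ∈ X₀ := Set.mem_of_indicator_ne_zero h
    exact ⟨hσ, (hz σ (by rwa [Set.indicator_of_mem hσ] at h)).2⟩) hc₀ hsum₀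
  -- In degree `d`, adjust by a top cell of `X₀` so that the correction balances the sum over `Y`.
  obtain ⟨w, hw, hwz, hwsum⟩ : ∃ w : ι → ZMod 2, (∀ σ, w σ ≠ 0 → σ ∈ X₀ ∧ dim σ + 1 = n) ∧
      (∀ τ ∈ X₀, (w ᵥ* inc) τ = z τ) ∧ (n = d → ∑ σ, w σ = ∑ σ, Y.indicator z σ) := by
    have hwz₀' : ∀ τ ∈ X₀, (w₀ ᵥ* inc) τ = z τ := fun τ hτ => by
      rw [hwz₀ τ hτ, Set.indicator_of_mem hτ]
    by_cases hn : n = d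
    · obtain ⟨σ₀, hσ₀, hσd⟩ := b₀.exists_top
      refine ⟨w₀ + Pi.single σ₀ (∑ σ, Y.indicator z σ - ∑ σ, w₀ σ), ?_, ?_, fun _ => ?_⟩
      · intro σ hσ
        by_cases h : w₀ σ = 0
        · have : σ = σ₀ := by
            by_contra hne
            simp [h, hne] at hσ
          subst this
          exact ⟨hσ₀, by omega⟩
        · exact hw₀ σ h
      · intro τ hτ
        rw [add_vecMul, Pi.add_apply, hwz₀' τ hτ, vecMul_apply_eq_zero, add_zero]
        intro σ hσ
        have : σ = σ₀ := by
          by_contra hne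
          simp [hne] at hσ
        subst this
        by_contra hne
        have := hinc σ τ hne
        have := b₀.dim_le τ hτ
        omega
      · simp [Finset.sum_add_distrib]
    · exact ⟨w₀, hw₀, hwz₀', fun h => absurd h hn⟩
  set z' : ι → ZMod 2 := z - X.indicator (w ᵥ* inc) with hz'
  have hz'supp : ∀ σ, z' σ ≠ 0 → σ ∈ X ∧ dim σ = n := by
    intro σ hσ
    by_cases h : z σ = 0
    · have h1 : X.indicator (w ᵥ* inc) σ ≠ 0 := fun h1 => hσ (by simp [hz', h, h1])
      have hσX := Set.mem_of_indicator_ne_zero h1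
      rw [Set.indicator_of_mem hσX] at h1
      refine ⟨hσX, ?_⟩
      by_contra hdim
      refine h1 (vecMul_apply_eq_zero fun ρ hρ => ?_)
      by_contra hne
      have := hinc ρ σ hne
      have := (hw ρ hρ).2
      omega
    · exact hz σ h
  have hz'₀ : ∀ σ ∈ X₀, z' σ = 0 := fun σ hσ => by
    simp [hz', h₀X hσ, hwz σ hσ]
  have hz'c : ∀ τ ∈ X, (z' ᵥ* inc) τ = 0 := by
    intro τ hτ
    have h1 : ((w ᵥ* inc) ᵥ* inc) τ = 0 := by rw [vecMul_vecMul, hsq, vecMul_zero]; rfl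
    have h2 : (X.indicator (w ᵥ* inc) ᵥ* inc) τ = 0 := by
      rw [← h1, ← sub_eq_zero, ← Pi.sub_apply, ← sub_vecMul]
      refine vecMul_apply_eq_zero fun ρ hρ => ?_
      by_contra hne
      by_cases hρX : ρ ∈ X
      · simp [hρX] at hρ
      · rw [Pi.sub_apply, Set.indicator_of_notMem hρX, zero_sub, neg_ne_zero] at hρ
        refine hρ (vecMul_apply_eq_zero fun σ hσ => ?_)
        by_contra hne'
        exact hρX (hconv σ (h₀X (hw σ hσ).1) τ hτ ρ hne' hne)
    rw [hz', sub_vecMul, Pi.sub_apply, hcz τ hτ, h2, sub_zero]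
  have hside : ∀ W : Set ι, W ⊆ X → n = d → (∀ σ ∈ X₀, dim σ + 1 = d →
      ∑ τ, W.indicator (inc σ) τ = 1) → ∑ σ, W.indicator z σ = ∑ σ, w σ →
      ∑ σ, W.indicator z' σ = 0 := by
    intro W hWX hn hW hWz
    have h1 : W.indicator z' = W.indicator z - W.indicator (w ᵥ* inc) := by
      funext σ
      by_cases h : σ ∈ W
      · simp [h, hz', hWX h]
      · simp [h]
    rw [h1]
    simp only [Pi.sub_apply, Finset.sum_sub_distrib]
    rw [sum_indicator_vecMul, hWz, sub_eq_zero]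
    refine Finset.sum_congr rfl fun σ _ => ?_
    by_cases hσ : w σ = 0
    · simp [hσ]
    · rw [hW σ (hw σ hσ).1 (by rw [(hw σ hσ).2, hn]), mul_one]
  obtain ⟨wY, hwY, hwYz⟩ := bY.exact_part hYX hYup (fun σ h => (hz'supp σ h).2)
    (fun σ hσ hσY τ hτ => by
      by_contra hne
      rcases (hX σ).1 (hz'supp σ hσ).1 with h | h | h
      · exact hσY h
      · exact hσ (hz'₀ σ h)
      · exact dYZ τ hτ (hZup σ h τ (hYX hτ) hne)) hz'c
    (fun hn => hside Y hYX hn hY (hwsum hn).symm)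
  obtain ⟨wZ, hwZ, hwZz⟩ := bZ.exact_part hZX hZup (fun σ h => (hz'supp σ h).2)
    (fun σ hσ hσZ τ hτ => by
      by_contra hne
      rcases (hX σ).1 (hz'supp σ hσ).1 with h | h | h
      · exact dYZ τ (hYup σ h τ (hZX hτ) hne) hτ
      · exact hσ (hz'₀ σ h)
      · exact hσZ h) hz'c
    (fun hn => hside Z hZX hn hZ (by
      have h0 : ∑ σ, X₀.indicator z σ = 0 := by
        refine Finset.sum_eq_zero fun σ _ => ?_
        by_cases h : σ ∈ X₀
        · rw [Set.indicator_of_mem h]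
          by_contra hne
          have := (hz σ hne).2
          have := b₀.dim_le σ h
          omega
        · rw [Set.indicator_of_notMem h]
      have h1 := splitsum z
      rw [hzX, hsum hn, h0, add_zero] at h1
      rw [hwsum hn, ← sub_eq_zero, CharTwo.sub_eq_add, add_comm]
      exact h1.symm))
  refine ⟨w + wY + wZ, fun σ hσ => ?_, fun τ hτ => ?_⟩
  · by_cases h1 : w σ = 0
    · by_cases h2 : wY σ = 0
      · have h3 : wZ σ ≠ 0 := fun h3 => hσ (by simp [h1, h2, h3])
        exact ⟨hZX (hwZ σ h3).1, (hwZ σ h3).2⟩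
      · exact ⟨hYX (hwY σ h2).1, (hwY σ h2).2⟩
    · exact ⟨h₀X (hw σ h1).1, (hw σ h1).2⟩
  · rw [add_vecMul, add_vecMul, Pi.add_apply, Pi.add_apply, hwYz τ hτ, hwZz τ hτ]
    have h1 := congrFun (split z') τ
    rw [Set.indicator_of_mem hτ] at h1
    simp only [Pi.add_apply] at h1
    have h2 : X₀.indicator z' τ = 0 := by
      by_cases h : τ ∈ X₀
      · rw [Set.indicator_of_mem h, hz'₀ τ h]
      · rw [Set.indicator_of_notMem h]
    rw [h2, add_zero] at h1
    rw [add_assoc, ← h1]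
    simp [hz', hτ]

end Ball

/-! ### Dimension and incidence of the cells -/

section Incidence

variable {P : Type*} [PartialOrder P] {S : Set P} {lam : S → ℝ}

theorem IdealChain.IsStep.pt_eq [Finite P] {L : AdmChain lam} {I J : LowerSet P}
    (h : L.1.IsStep I J) {p q : P} (hp : p ∈ gap I J) (hq : q ∈ gap I J) : L.pt p = L.pt q :=
  le_antisymm (le_of_not_gt ((L.lt_iff q p).not.1 (h.not_lt hq hp)))
    (le_of_not_gt ((L.lt_iff p q).not.1 (h.not_lt hp hq)))

theorem IdealChain.IsStep.eq_of_pt_eq [Finite P] {L : AdmChain lam} {I J I' J' : LowerSet P}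
    (h : L.1.IsStep I J) (h' : L.1.IsStep I' J') {p q : P} (hp : p ∈ gap I J) (hq : q ∈ gap I' J')
    (hpq : L.pt p = L.pt q) : I = I' ∧ J = J' :=
  h.eq_of_not_lt h' hp hq (fun hlt => ((L.lt_iff p q).1 hlt).ne hpq)
    fun hlt => ((L.lt_iff q p).1 hlt).ne' hpq

/-- The directions along which the values on the differences of `L` can vary have one coordinate
for each difference without marked elements. -/
theorem AdmChain.finrank_constSub [Finite P] (L : AdmChain lam) :
    Module.finrank ℝ (constSub S (tight Set.univ L.pt)) = L.dim := by
  classical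
  let T : Set (LowerSet P × LowerSet P) := {s | L.1.IsStep s.1 s.2 ∧ gap s.1 s.2 ∩ S = ∅}
  have : Fintype T := Fintype.ofFinite T
  choose rep hrep using fun s : T => s.2.1.gap_nonempty
  let f : constSub S (tight Set.univ L.pt) →ₗ[ℝ] (T → ℝ) :=
    { toFun := fun v s => v.1 (rep s)
      map_add' := fun _ _ => rfl
      map_smul' := fun _ _ => rfl }
  have hf : Function.Bijective f := by
    constructor
    · rw [← LinearMap.ker_eq_bot, LinearMap.ker_eq_bot']
      rintro ⟨v, hv0, hv⟩ hfv
      ext p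
      change v p = 0
      obtain ⟨I, J, hIJ, hp⟩ := L.1.exists_isStep_mem_gap p
      by_cases he : gap I J ∩ S = ∅
      · have := congrFun hfv ⟨(I, J), hIJ, he⟩
        rw [hv p (rep ⟨(I, J), hIJ, he⟩) ⟨trivial, hIJ.pt_eq hp (hrep ⟨(I, J), hIJ, he⟩)⟩]
        exact this
      · obtain ⟨a, ha, haS⟩ := Set.nonempty_iff_ne_empty.2 he
        rw [hv p a ⟨trivial, hIJ.pt_eq hp ha⟩]
        exact hv0 ⟨a, haS⟩
    · intro g
      choose I J hIJ hmem using L.1.exists_isStep_mem_gap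
      refine ⟨⟨fun p => if h : (I p, J p) ∈ T then g ⟨_, h⟩ else 0, fun a => dif_neg ?_, ?_⟩, ?_⟩
      · rintro ⟨-, h⟩
        exact Set.eq_empty_iff_forall_notMem.1 h a ⟨hmem a, a.2⟩
      · rintro p q ⟨-, hpq⟩
        obtain ⟨h1, h2⟩ := (hIJ p).eq_of_pt_eq (hIJ q) (hmem p) (hmem q) hpq
        simp only [h1, h2]
      · funext s
        obtain ⟨h1, h2⟩ := (hIJ (rep s)).eq_of_pt_eq s.2.1 (hmem _) (hrep s) rfl
        have h3 : (I (rep s), J (rep s)) = s.1 := Prod.ext h1 h2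
        change (if h : (I (rep s), J (rep s)) ∈ T then g ⟨_, h⟩ else 0) = g s
        rw [dif_pos (h3 ▸ s.2)]
        congr 1
        exact Subtype.ext h3
  rw [(LinearEquiv.ofBijective f hf).finrank_eq, Module.finrank_fintype_fun_eq_card,
    ← Nat.card_eq_fintype_card, Nat.card_coe_set_eq]
  rfl

theorem AdmChain.exists_isCondensation {L L' : AdmChain lam} {J : LowerSet P}
    [DecidableEq (LowerSet P)]
    (hJ : J ∉ L.1.ideals) (h : L'.1.ideals = insert J L.1.ideals) :
    ∃ I K, IsCondensation L I K J L' := by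
  classical
  obtain ⟨K, hK⟩ := (L.1.ideals.filter (J ≤ ·)).exists_minimal
    ⟨⊤, Finset.mem_filter.2 ⟨L.1.top_mem, le_top⟩⟩
  obtain ⟨hKL, hJK⟩ := Finset.mem_filter.1 hK.1
  have hbot : K ≠ ⊥ := by
    rintro rfl
    exact hJ (le_bot_iff.1 hJK ▸ L.1.bot_mem)
  obtain ⟨I, hI⟩ := L.1.exists_isStep_of_ne_bot hKL hbot
  have hJI : ¬ J ≤ I := fun hle =>
    hI.2.2.1.not_ge (hK.2 (Finset.mem_filter.2 ⟨hI.1, hle⟩) hI.2.2.1.le)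
  have htot := L'.1.isChain.total (x := I) (y := J)
    (by rw [h]; exact Finset.mem_insert_of_mem hI.1) (by rw [h]; exact Finset.mem_insert_self _ _)
  refine ⟨I, K, hI, lt_of_le_of_ne (htot.resolve_right hJI) fun e => hJI e.ge,
    lt_of_le_of_ne hJK fun e => hJ (e ▸ hKL), ?_⟩
  rw [h]
  congr!

/-- Chains between two admissible chains are admissible. -/
theorem AdmChain.exists_insert {L L' : AdmChain lam} [DecidableEq (LowerSet P)] (h : L ≤ L')
    {J : LowerSet P} (hJ : J ∈ L'.1.ideals) :
    ∃ M : AdmChain lam, M.1.ideals = insert J L.1.ideals ∧ L ≤ M ∧ M ≤ L' := by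
  have hsub : insert J L.1.ideals ⊆ L'.1.ideals := Finset.insert_subset hJ h
  let M : IdealChain P :=
    { ideals := insert J L.1.ideals
      bot_mem := Finset.mem_insert_of_mem L.1.bot_mem
      top_mem := Finset.mem_insert_of_mem L.1.top_mem
      isChain := L'.1.isChain.mono (by exact_mod_cast hsub) }
  have h1 : ∀ p q, L.1.Lt p q → M.Lt p q :=
    IdealChain.ideals_subset_iff.1 (Finset.subset_insert _ _)
  have h2 : ∀ p q, M.Lt p q → L'.1.Lt p q := IdealChain.ideals_subset_iff.1 hsub
  exact ⟨⟨M, IdealChain.isAdmissible_iff.2 fun a b =>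
    ⟨fun h => (L'.lt_iff_lam a b).1 (h2 _ _ h), fun h => h1 _ _ ((L.lt_iff_lam a b).2 h)⟩⟩,
    rfl, Finset.subset_insert _ _, hsub⟩

theorem AdmChain.dim_add_card [Finite P] {L L' : AdmChain lam} (h : L ≤ L') :
    L.dim + L'.1.ideals.card = L'.dim + L.1.ideals.card := by
  classical
  induction hn : (L'.1.ideals \ L.1.ideals).card generalizing L with
  | zero =>
    rw [Finset.card_eq_zero, Finset.sdiff_eq_empty_iff_subset] at hn
    rw [le_antisymm h hn]
  | succ n ih =>
    obtain ⟨J, hJ⟩ := Finset.card_pos.1 (show 0 < (L'.1.ideals \ L.1.ideals).card by omega)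
    obtain ⟨hJ', hJL⟩ := Finset.mem_sdiff.1 hJ
    obtain ⟨M, hM, -, hML'⟩ := AdmChain.exists_insert h hJ'
    obtain ⟨I, K, hc⟩ := AdmChain.exists_isCondensation hJL hM
    have h1 := ih hML' (by
      rw [hM, Finset.sdiff_insert, Finset.card_erase_of_mem hJ, hn]
      rfl)
    rw [hc.dim_eq, hM, Finset.card_insert_of_notMem hJL] at h1
    omega

theorem AdmChain.exists_isCondensation_of_le [Finite P] {L L' : AdmChain lam} (h : L ≤ L')
    (hdim : L'.dim = L.dim + 1) : ∃ I K J, IsCondensation L I K J L' := by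
  classical
  have hcard := AdmChain.dim_add_card h
  obtain ⟨J, hJ⟩ := Finset.card_eq_one.1 (show (L'.1.ideals \ L.1.ideals).card = 1 by
    rw [Finset.card_sdiff_of_subset (AdmChain.le_def.1 h)]; omega)
  have hmem : J ∈ L'.1.ideals \ L.1.ideals := by rw [hJ]; exact Finset.mem_singleton_self J
  obtain ⟨I, K, hc⟩ := AdmChain.exists_isCondensation (L := L) (L' := L') (J := J)
    (Finset.mem_sdiff.1 hmem).2 (by
      rw [← Finset.sdiff_union_of_subset (AdmChain.le_def.1 h), hJ]; rfl)
  exact ⟨I, K, J, hc⟩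

variable (lam) in
open Classical in
/-- The mod 2 incidence matrix of the cells `F_L`: the entry at `(L, L')` is `1` if `F_L` is a facet
of `F_{L'}`. -/
noncomputable def incidence [Finite P] : Matrix (AdmChain lam) (AdmChain lam) (ZMod 2) :=
  Matrix.of fun L L' => if L ≤ L' ∧ L'.dim = L.dim + 1 then 1 else 0

theorem incidence_ne_zero_iff [Finite P] {L L' : AdmChain lam} :
    incidence lam L L' ≠ 0 ↔ L ≤ L' ∧ L'.dim = L.dim + 1 := by
  simp [incidence]

theorem incidence_eq_one [Finite P] {L L' : AdmChain lam} (h : L ≤ L' ∧ L'.dim = L.dim + 1) :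
    incidence lam L L' = 1 := by
  simp only [incidence, Matrix.of_apply, h]
  simp

/-- Between two cells whose dimensions differ by two there are exactly two cells. -/
theorem incidence_mul_self [Finite P] : incidence lam * incidence lam = 0 := by
  classical
  ext L L'
  rw [Matrix.mul_apply, Matrix.zero_apply]
  by_cases hex : ∃ M, incidence lam L M * incidence lam M L' ≠ 0
  swap
  · push Not at hex
    exact Finset.sum_eq_zero fun M _ => hex M
  obtain ⟨M, hM⟩ := hex
  obtain ⟨hLM, hdM⟩ := incidence_ne_zero_iff.1 (left_ne_zero_of_mul hM)
  obtain ⟨hML', hdL'⟩ := incidence_ne_zero_iff.1 (right_ne_zero_of_mul hM)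
  have hLL' := hLM.trans hML'
  have hcard := AdmChain.dim_add_card hLL'
  obtain ⟨J₁, J₂, hne, hJ⟩ := Finset.card_eq_two.1
    (show (L'.1.ideals \ L.1.ideals).card = 2 by rw [Finset.card_sdiff_of_subset (AdmChain.le_def.1 hLL')]; omega)
  have hmem₁ : J₁ ∈ L'.1.ideals \ L.1.ideals := by rw [hJ]; simp
  have hmem₂ : J₂ ∈ L'.1.ideals \ L.1.ideals := by rw [hJ]; simp
  rw [Finset.mem_sdiff] at hmem₁ hmem₂
  have key : ∀ N : AdmChain lam, ∀ J, J ∈ L'.1.ideals → J ∉ L.1.ideals →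
      N.1.ideals = insert J L.1.ideals → L ≤ N → N ≤ L' →
      incidence lam L N * incidence lam N L' = 1 := by
    intro N J hJ' hJL hN h1 h2
    have c1 := AdmChain.dim_add_card h1
    rw [hN, Finset.card_insert_of_notMem hJL] at c1
    rw [incidence_eq_one ⟨h1, by omega⟩, incidence_eq_one ⟨h2, by omega⟩, one_mul]
  obtain ⟨N₁, hN₁, h1, h2⟩ := AdmChain.exists_insert hLL' hmem₁.1
  obtain ⟨N₂, hN₂, h3, h4⟩ := AdmChain.exists_insert hLL' hmem₂.1
  have hN : N₁ ≠ N₂ := by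
    rintro rfl
    have : J₁ ∈ insert J₂ L.1.ideals := by rw [← hN₂, hN₁]; simp
    rcases Finset.mem_insert.1 this with h | h
    exacts [hne h, hmem₁.2 h]
  rw [Finset.sum_eq_add N₁ N₂ hN ?_ (by simp) (by simp),
    key N₁ J₁ hmem₁.1 hmem₁.2 hN₁ h1 h2, key N₂ J₂ hmem₂.1 hmem₂.2 hN₂ h3 h4]
  · decide
  · rintro N - ⟨hn1, hn2⟩
    by_contra h0
    obtain ⟨hLN, hdN⟩ := incidence_ne_zero_iff.1 (left_ne_zero_of_mul h0)
    obtain ⟨hNL', -⟩ := incidence_ne_zero_iff.1 (right_ne_zero_of_mul h0)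
    obtain ⟨I, K, J, hc⟩ := AdmChain.exists_isCondensation_of_le hLN hdN
    have hNJ : N.1.ideals = insert J L.1.ideals := by rw [hc.2.2.2]
    have hJL : J ∉ L.1.ideals := fun h => hc.1.2.2.2 J h ⟨hc.2.1, hc.2.2.1⟩
    have hJ' : J ∈ L'.1.ideals \ L.1.ideals :=
      Finset.mem_sdiff.2 ⟨AdmChain.le_def.1 hNL' (by rw [hNJ]; simp), hJL⟩
    rw [hJ, Finset.mem_insert, Finset.mem_singleton] at hJ'
    rcases hJ' with rfl | rfl
    · exact hn1 (Subtype.ext (IdealChain.ext (hNJ.trans hN₁.symm)))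
    · exact hn2 (Subtype.ext (IdealChain.ext (hNJ.trans hN₂.symm)))

end Incidence

/-! ### Regions of cells with prescribed comparisons are balls -/

theorem constSub_insert {P : Type*} {S : Set P} {E : Set (P × P)} {p q : P} {v : P → ℝ} :
    v ∈ constSub S (insert (p, q) E) ↔ v ∈ constSub S E ∧ v p = v q := by
  simp only [mem_constSub, Set.mem_insert_iff, Prod.mk.injEq]
  constructor
  · rintro ⟨h0, h⟩
    exact ⟨⟨h0, fun r s hrs => h r s (Or.inr hrs)⟩, h p q (Or.inl ⟨rfl, rfl⟩)⟩
  · rintro ⟨⟨h0, h⟩, hpq⟩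
    refine ⟨h0, ?_⟩
    rintro r s (⟨rfl, rfl⟩ | hrs)
    exacts [hpq, h r s hrs]

theorem finrank_constSub_insert {P : Type*} [Finite P] {S : Set P} {E : Set (P × P)} {p q : P}
    {v : P → ℝ} (hv : v ∈ constSub S E) (hpq : v p ≠ v q) :
    Module.finrank ℝ (constSub S (insert (p, q) E)) + 1 = Module.finrank ℝ (constSub S E) := by
  let f : constSub S E →ₗ[ℝ] ℝ :=
    ((LinearMap.proj p : (P → ℝ) →ₗ[ℝ] ℝ) - LinearMap.proj q) ∘ₗ (constSub S E).subtype
  have hf : ∀ w, f w = w.1 p - w.1 q := fun _ => rfl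
  have hsurj : Function.Surjective f := by
    intro c
    refine ⟨(c / (v p - v q)) • ⟨v, hv⟩, ?_⟩
    rw [map_smul, hf, smul_eq_mul, div_mul_cancel₀ _ (sub_ne_zero.2 hpq)]
  have hker : constSub S (insert (p, q) E) = (LinearMap.ker f).map (constSub S E).subtype := by
    ext w
    rw [constSub_insert]
    simp only [Submodule.mem_map, LinearMap.mem_ker, hf, sub_eq_zero, Submodule.subtype_apply,
      Subtype.exists, exists_and_left, exists_prop]
    constructor
    · rintro ⟨h1, h2⟩
      exact ⟨w, h2, h1, rfl⟩
    · rintro ⟨w, h2, h1, rfl⟩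
      exact ⟨h1, h2⟩
  have h1 := LinearMap.finrank_range_add_finrank_ker f
  rw [LinearMap.range_eq_top.2 hsurj, finrank_top, Module.finrank_self] at h1
  rw [hker, Submodule.finrank_map_subtype_eq, ← h1, add_comm]

section Region

variable {P : Type*} [PartialOrder P] [Finite P] {S : Set P} {lam : S → ℝ}

/-- The cells that compare the two elements of each pair in `D` in the same way as `L₀`. -/
def region (L₀ : AdmChain lam) (D : Set (P × P)) : Set (AdmChain lam) :=
  {L | ∀ p q, (p, q) ∈ D →
    (L.pt p < L.pt q ↔ L₀.pt p < L₀.pt q) ∧ (L.pt q < L.pt p ↔ L₀.pt q < L₀.pt p)}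

variable {L₀ L L' : AdmChain lam} {D : Set (P × P)}

theorem self_mem_region : L₀ ∈ region L₀ D := fun _ _ _ => ⟨Iff.rfl, Iff.rfl⟩

theorem eq_iff_of_mem_region (h : L ∈ region L₀ D) {p q : P} (hD : (p, q) ∈ D) :
    L.pt p = L.pt q ↔ L₀.pt p = L₀.pt q := by
  have h1 := h p q hD
  constructor
  · intro e
    exact le_antisymm (not_lt.1 (h1.2.not.1 e.not_gt)) (not_lt.1 (h1.1.not.1 e.not_lt))
  · intro e
    exact le_antisymm (not_lt.1 (h1.2.not.2 e.not_gt)) (not_lt.1 (h1.1.not.2 e.not_lt))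

theorem tight_eq_of_mem_region (h : L ∈ region L₀ D) : tight D L.pt = tight D L₀.pt := by
  ext ⟨p, q⟩
  simp only [mem_tight]
  exact and_congr_right fun hD => eq_iff_of_mem_region h hD

theorem mem_region_insert {p q : P} :
    L ∈ region L₀ (insert (p, q) D) ↔ L ∈ region L₀ D ∧
      (L.pt p < L.pt q ↔ L₀.pt p < L₀.pt q) ∧ (L.pt q < L.pt p ↔ L₀.pt q < L₀.pt p) := by
  simp only [region, Set.mem_ofPred_eq, Set.mem_insert_iff, Prod.mk.injEq]
  constructor
  · exact fun h => ⟨fun r s hrs => h r s (Or.inr hrs), h p q (Or.inl ⟨rfl, rfl⟩)⟩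
  · rintro ⟨h1, h2⟩ r s (⟨rfl, rfl⟩ | hrs)
    exacts [h2, h1 r s hrs]

theorem sub_mem_constSub (h : L ∈ region L₀ D) : L.pt - L₀.pt ∈ constSub S (tight D L₀.pt) := by
  refine ⟨fun a => by simp [L.pt_lam, L₀.pt_lam], fun p q hpq => ?_⟩
  simp [(mem_tight.1 hpq).2, (eq_iff_of_mem_region h hpq.1).2 (mem_tight.1 hpq).2]

theorem mem_region_of_between {M : AdmChain lam} (hL : L ∈ region L₀ D) (hL' : L' ∈ region L₀ D)
    (h1 : L ≤ M) (h2 : M ≤ L') : M ∈ region L₀ D := by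
  rw [AdmChain.le_iff] at h1 h2
  intro p q hD
  have a := hL p q hD
  have b := hL' p q hD
  exact ⟨⟨fun h => b.1.1 (h2 _ _ h), fun h => h1 _ _ (a.1.2 h)⟩,
    ⟨fun h => b.2.1 (h2 _ _ h), fun h => h1 _ _ (a.2.2 h)⟩⟩

/-- The points that compare the pairs in `D` as `L₀` does belong to cells of the region. -/
theorem exists_mem_region (hD : ∀ p q : P, p ≤ q → (p, q) ∈ D) {x : P → ℝ}
    (hx0 : ∀ a : S, x a = lam a)
    (hx : ∀ p q, (p, q) ∈ D → (x p < x q ↔ L₀.pt p < L₀.pt q) ∧ (x q < x p ↔ L₀.pt q < L₀.pt p)) :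
    ∃ M ∈ region L₀ D, ∀ p q, M.pt p < M.pt q ↔ x p < x q := by
  have hmono : Monotone x := fun p q h =>
    not_lt.1 ((hx p q (hD p q h)).2.not.2 (L₀.pt_mono h).not_gt)
  obtain ⟨M, hM⟩ := exists_admChain hmono hx0
  exact ⟨M, fun p q h => by rw [hM, hM]; exact hx p q h, hM⟩

/-- Moving from a cell `L` of the region in the direction `v` leads into a cell of the region
above `L`. -/
theorem exists_perturbed (hD : ∀ p q : P, p ≤ q → (p, q) ∈ D) (hL : L ∈ region L₀ D) {v : P → ℝ}
    (hv : v ∈ constSub S (tight D L₀.pt)) :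
    ∃ M ∈ region L₀ D, L ≤ M ∧
      ∀ r s, M.pt r < M.pt s ↔ L.pt r < L.pt s ∨ (L.pt r = L.pt s ∧ v r < v s) := by
  obtain ⟨ε, hε, h⟩ := exists_pos_perturbation L.pt v
  have hy : ∀ r s, (L.pt + ε • v) r < (L.pt + ε • v) s ↔
      L.pt r < L.pt s ∨ (L.pt r = L.pt s ∧ v r < v s) := by
    intro r s
    simp only [Pi.add_apply, Pi.smul_apply, smul_eq_mul]
    rcases lt_trichotomy (L.pt r) (L.pt s) with h1 | h1 | h1
    · simp [h1, h r s h1]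
    · simp [h1, hε]
    · simp [h1.not_gt, h1.ne', (h s r h1).le]
  obtain ⟨M, hM, hMy⟩ := exists_mem_region (L₀ := L₀) hD (x := L.pt + ε • v)
    (fun a => by simp [L.pt_lam, hv.1]) (fun p q hpq => by
      have h1 := hL p q hpq
      have h2 : L.pt p = L.pt q → v p = v q := fun e =>
        hv.2 p q ⟨hpq, (eq_iff_of_mem_region hL hpq).1 e⟩
      rw [hy, hy, ← h1.1, ← h1.2]
      constructor
      · exact or_iff_left fun ⟨e, hlt⟩ => hlt.ne (h2 e)
      · exact or_iff_left fun ⟨e, hlt⟩ => hlt.ne' (h2 e.symm))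
  have hMlt : ∀ r s, M.pt r < M.pt s ↔ L.pt r < L.pt s ∨ (L.pt r = L.pt s ∧ v r < v s) :=
    fun r s => (hMy r s).trans (hy r s)
  exact ⟨M, hM, AdmChain.le_iff.2 fun r s hrs => (hMlt r s).2 (Or.inl hrs), hMlt⟩

/-- A cell `L` of the region that spans the hyperplane `x p = x q` is a facet of exactly one cell
of the region on the side `x p < x q`. -/
theorem sum_incidence_side (hD : ∀ p q : P, p ≤ q → (p, q) ∈ D) (hL : L ∈ region L₀ D) {p q : P}
    (hpq : L.pt p = L.pt q)
    (hspan : ∀ w ∈ constSub S (tight D L₀.pt), w p = w q → w ∈ constSub S (tight Set.univ L.pt))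
    {v : P → ℝ} (hv : v ∈ constSub S (tight D L₀.pt)) (hvpq : v p < v q)
    (hdim : L.dim + 1 = Module.finrank ℝ (constSub S (tight D L₀.pt))) :
    ∑ M, Set.indicator {M | M ∈ region L₀ D ∧ M.pt p < M.pt q} (incidence lam L) M = 1 := by
  classical
  obtain ⟨M, hM, hLM, hlt⟩ := exists_perturbed hD hL hv
  -- Every `w` in the direction space is a multiple of `v` plus a vector constant on the classes
  -- of `L`.
  have hdec : ∀ w ∈ constSub S (tight D L₀.pt), ∃ c : ℝ, c * (v p - v q) = w p - w q ∧
      ∀ r s, L.pt r = L.pt s → w r - w s = c * (v r - v s) := by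
    intro w hw
    have hne : v p - v q ≠ 0 := sub_ne_zero.2 hvpq.ne
    refine ⟨(w p - w q) / (v p - v q), div_mul_cancel₀ _ hne, fun r s hrs => ?_⟩
    have h1 := hspan (w - ((w p - w q) / (v p - v q)) • v)
      (sub_mem hw (Submodule.smul_mem _ _ hv)) (by
        simp only [Pi.sub_apply, Pi.smul_apply, smul_eq_mul]
        have := div_mul_cancel₀ (w p - w q) hne
        linarith)
    have h2 := h1.2 r s ⟨trivial, hrs⟩
    simp only [Pi.sub_apply, Pi.smul_apply, smul_eq_mul] at h2
    linarith
  have hMdim : M.dim = L.dim + 1 := by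
    suffices h : constSub S (tight Set.univ M.pt) = constSub S (tight D L₀.pt) by
      rw [hdim, ← M.finrank_constSub, h]
    apply le_antisymm
    · rw [← tight_eq_of_mem_region hM]
      exact constSub_anti fun s hs => ⟨trivial, hs.2⟩
    · intro w hw
      refine ⟨hw.1, fun r s hrs => ?_⟩
      have hne : ∀ r s, M.pt r = M.pt s → L.pt r ≤ L.pt s ∧ (L.pt r = L.pt s → v r ≤ v s) := by
        intro r s e
        have := (hlt s r).not.1 e.not_gt
        push Not at this
        exact ⟨this.1, fun h => this.2 h.symm⟩
      obtain ⟨h1, h2⟩ := hne r s hrs.2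
      obtain ⟨h3, h4⟩ := hne s r hrs.2.symm
      have e : L.pt r = L.pt s := le_antisymm h1 h3
      obtain ⟨c, -, hc⟩ := hdec w hw
      have := hc r s e
      rw [le_antisymm (h2 e) (h4 e.symm), sub_self, mul_zero, sub_eq_zero] at this
      exact this
  have hMside : M ∈ {M | M ∈ region L₀ D ∧ M.pt p < M.pt q} :=
    ⟨hM, (hlt p q).2 (Or.inr ⟨hpq, hvpq⟩)⟩
  rw [Finset.sum_eq_single M, Set.indicator_of_mem hMside, incidence_eq_one ⟨hLM, hMdim⟩]
  · intro N _ hne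
    by_cases hN : N ∈ {M | M ∈ region L₀ D ∧ M.pt p < M.pt q}
    swap
    · rw [Set.indicator_of_notMem hN]
    rw [Set.indicator_of_mem hN]
    by_contra h0
    have hLN := AdmChain.le_iff.1 (incidence_ne_zero_iff.1 h0).1
    refine hne (AdmChain.ext_pt fun r s => ?_)
    obtain ⟨c, hc1, hc2⟩ := hdec (N.pt - L.pt) (by
      rw [← tight_eq_of_mem_region hL]
      exact sub_mem_constSub fun p q h => by
        have h1 := hN.1 p q h
        have h2 := hL p q h
        exact ⟨h1.1.trans h2.1.symm, h1.2.trans h2.2.symm⟩)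
    have hc : 0 < c := by
      have := hN.2
      simp only [Pi.sub_apply] at hc1
      nlinarith
    rw [hlt]
    rcases lt_trichotomy (L.pt r) (L.pt s) with h | h | h
    · simp [h, hLN _ _ h]
    · have h1 := hc2 r s h
      simp only [Pi.sub_apply] at h1
      rw [or_iff_right h.not_lt, and_iff_right h, ← sub_neg, ← sub_neg (a := v r)]
      have h2 : N.pt r - N.pt s = c * (v r - v s) := by linarith
      rw [h2, mul_neg_iff]
      constructor
      · rintro (h | h)
        exacts [h.2, absurd h.1 hc.not_gt]
      · exact fun h => Or.inl ⟨hc, h⟩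
    · simp [h.not_gt, h.ne', (hLN _ _ h).not_gt]
  · simp

/-- A convex combination has the sign that both its members have. -/
theorem convex_comb_neg_iff {a b t : ℝ} (h0 : 0 ≤ t) (h1 : t ≤ 1) (h : a < 0 ↔ b < 0) :
    (1 - t) * a + t * b < 0 ↔ a < 0 := by
  constructor
  · intro hlt
    by_contra ha
    have hb := mt h.2 ha
    rw [not_lt] at ha hb
    have := mul_nonneg (sub_nonneg.2 h1) ha
    have := mul_nonneg h0 hb
    linarith
  · intro ha
    have hb := h.1 ha
    rcases h0.eq_or_lt with rfl | ht
    · simpa using ha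
    · have := mul_nonneg (sub_nonneg.2 h1) (neg_nonneg.2 ha.le)
      have := mul_pos ht (neg_pos.2 hb)
      linarith

/-- If not all cells of a region compare `p` and `q` in the same way, then the hyperplane
`x p = x q` meets the region, and does not contain it. -/
theorem exists_cut (hD : ∀ p q : P, p ≤ q → (p, q) ∈ D) (hL : L ∈ region L₀ D) {p q : P}
    (hpq : L ∉ region L₀ (insert (p, q) D)) :
    (∃ M ∈ region L₀ D, M.pt p = M.pt q) ∧ ∃ v ∈ constSub S (tight D L₀.pt), v p ≠ v q := by
  set a := L₀.pt p - L₀.pt q with ha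
  set b := L.pt p - L.pt q with hb
  have hab : ¬ ((b < 0 ↔ a < 0) ∧ (0 < b ↔ 0 < a)) := by
    intro h
    rw [mem_region_insert] at hpq
    refine hpq ⟨hL, ?_⟩
    simpa only [ha, hb, sub_neg, sub_pos] using h
  have hne : a ≠ b := by
    intro e
    exact hab (by simp [e])
  refine ⟨?_, _, sub_mem_constSub hL, fun h => hne ?_⟩
  swap
  · simp only [Pi.sub_apply] at h
    linarith
  -- The segment from `L₀` to `L` crosses the hyperplane at the parameter `a / (a - b)`.
  have hsign : a * b ≤ 0 := by
    by_contra! hc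
    rcases pos_and_pos_or_neg_and_neg_of_mul_pos hc with ⟨h1, h2⟩ | ⟨h1, h2⟩
    · exact hab (by simp [h1, h2, h1.not_gt, h2.not_gt])
    · exact hab (by simp [h1, h2, h1.not_gt, h2.not_gt])
  have hne' : a - b ≠ 0 := sub_ne_zero.2 hne
  set t := a / (a - b) with ht
  have hta : t * (a - b) = a := div_mul_cancel₀ _ hne'
  have ht0 : 0 ≤ t := by
    have : 0 ≤ a * (a - b) := by nlinarith [sq_nonneg a]
    rw [ht, ← mul_div_mul_right a (a - b) hne']
    exact div_nonneg this (mul_self_nonneg _)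
  have ht1 : t ≤ 1 := by
    have h2 : 1 - t = (-b) * (a - b) / ((a - b) * (a - b)) := by
      rw [mul_div_mul_right _ _ hne', ht]
      field_simp
      ring
    have : 0 ≤ 1 - t := by
      rw [h2]
      exact div_nonneg (by nlinarith [sq_nonneg b]) (mul_self_nonneg _)
    linarith
  have hx : ∀ r s, (L₀.pt + t • (L.pt - L₀.pt)) r - (L₀.pt + t • (L.pt - L₀.pt)) s =
      (1 - t) * (L₀.pt r - L₀.pt s) + t * (L.pt r - L.pt s) := by
    intro r s
    simp only [Pi.add_apply, Pi.smul_apply, Pi.sub_apply, smul_eq_mul]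
    ring
  obtain ⟨M, hM, hMx⟩ := exists_mem_region (L₀ := L₀) hD (x := L₀.pt + t • (L.pt - L₀.pt))
    (fun c => by simp [L.pt_lam, L₀.pt_lam]) (fun r s hrs => by
      have h1 := hL r s hrs
      have key : ∀ r s, (L.pt r < L.pt s ↔ L₀.pt r < L₀.pt s) →
          ((L₀.pt + t • (L.pt - L₀.pt)) r < (L₀.pt + t • (L.pt - L₀.pt)) s ↔
            L₀.pt r < L₀.pt s) := by
        intro r s h
        rw [← sub_neg, hx, ← sub_neg (a := L₀.pt r)]
        exact convex_comb_neg_iff ht0 ht1 (by simpa only [sub_neg] using h.symm)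
      exact ⟨key r s h1.1, key s r h1.2⟩)
  have hxpq : (L₀.pt + t • (L.pt - L₀.pt)) p = (L₀.pt + t • (L.pt - L₀.pt)) q := by
    rw [← sub_eq_zero, hx]
    linarith
  refine ⟨M, hM, le_antisymm (not_lt.1 ?_) (not_lt.1 ?_)⟩
  · rw [hMx, hxpq]
    exact lt_irrefl _
  · rw [hMx, hxpq]
    exact lt_irrefl _

theorem region_eq_of_mem (hL : L ∈ region L₀ D) : region L D = region L₀ D := by
  ext M
  refine forall_congr' fun p => forall_congr' fun q => forall_congr' fun h => ?_
  rw [(hL p q h).1, (hL p q h).2]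

/-- A region is a ball, of the dimension of the linear space that its equations define: cut it by
the remaining hyperplanes, one at a time. -/
theorem isBall_region (hD : ∀ p q : P, p ≤ q → (p, q) ∈ D) (L₀ : AdmChain lam) :
    IsBall (incidence lam) AdmChain.dim (region L₀ D)
      (Module.finrank ℝ (constSub S (tight D L₀.pt))) := by
  classical
  induction hn : Dᶜ.ncard generalizing D L₀ with
  | zero =>
    have hDu : D = Set.univ := by
      rw [Set.ncard_eq_zero, Set.compl_empty_iff] at hn
      exact hn
    subst hDu
    have : region L₀ Set.univ = {L₀} := by
      ext L
      refine ⟨fun h => AdmChain.ext_pt fun p q => (h p q trivial).1, ?_⟩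
      rintro rfl
      exact self_mem_region
    rw [this, L₀.finrank_constSub]
    exact isBall_singleton L₀
  | succ n ih =>
    obtain ⟨⟨p, q⟩, hpq⟩ : (Dᶜ).Nonempty := Set.nonempty_of_ncard_ne_zero (by omega)
    have hcard : (insert (p, q) D)ᶜ.ncard = n := by
      have : (insert (p, q) D)ᶜ = Dᶜ \ {(p, q)} := by ext; simp [not_or, and_comm]
      rw [this, Set.ncard_sdiff_singleton_of_mem hpq, hn]
      rfl
    have hD' : ∀ r s : P, r ≤ s → (r, s) ∈ insert (p, q) D := fun r s h => Or.inr (hD r s h)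
    have ih' := fun L : AdmChain lam => ih hD' L hcard
    have htight : ∀ L ∈ region L₀ D, L.pt p ≠ L.pt q →
        tight (insert (p, q) D) L.pt = tight D L₀.pt := by
      intro L hL hne
      rw [← tight_eq_of_mem_region hL]
      ext ⟨r, s⟩
      simp only [mem_tight, Set.mem_insert_iff, Prod.mk.injEq]
      constructor
      · rintro ⟨⟨rfl, rfl⟩ | h, e⟩
        exacts [absurd e hne, ⟨h, e⟩]
      · exact fun h => ⟨Or.inr h.1, h.2⟩
    have htight₀ : ∀ L ∈ region L₀ D, L.pt p = L.pt q →
        tight (insert (p, q) D) L.pt = insert (p, q) (tight D L₀.pt) := by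
      intro L hL he
      rw [← tight_eq_of_mem_region hL]
      ext ⟨r, s⟩
      simp only [mem_tight, Set.mem_insert_iff, Prod.mk.injEq]
      constructor
      · rintro ⟨h | h, e⟩
        exacts [Or.inl h, Or.inr ⟨h, e⟩]
      · rintro (⟨rfl, rfl⟩ | h)
        exacts [⟨Or.inl ⟨rfl, rfl⟩, he⟩, ⟨Or.inr h.1, h.2⟩]
    by_cases hcut : (∃ M ∈ region L₀ D, M.pt p = M.pt q) ∧
        ∃ v ∈ constSub S (tight D L₀.pt), v p ≠ v q
    · obtain ⟨⟨M, hM, hMpq⟩, v, hv, hvpq⟩ := hcut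
      wlog hlt : v p < v q generalizing v
      · exact this (-v) (neg_mem hv) (by simpa using hvpq)
          (by simpa using lt_of_le_of_ne (not_lt.1 hlt) hvpq.symm)
      obtain ⟨Lp, hLp, -, hLpv⟩ := exists_perturbed hD hM hv
      obtain ⟨Lm, hLm, -, hLmv⟩ := exists_perturbed hD hM (neg_mem hv)
      have hp : Lp.pt p < Lp.pt q := (hLpv p q).2 (Or.inr ⟨hMpq, hlt⟩)
      have hm : Lm.pt q < Lm.pt p := (hLmv q p).2 (Or.inr ⟨hMpq.symm, by simpa using hlt⟩)
      have hYset : region Lp (insert (p, q) D) = {L | L ∈ region L₀ D ∧ L.pt p < L.pt q} := by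
        ext L
        rw [mem_region_insert, region_eq_of_mem hLp]
        simp only [hp, hp.not_gt, iff_true, iff_false, Set.mem_ofPred_eq]
        exact and_congr_right fun _ => ⟨fun h => h.1, fun h => ⟨h, h.not_gt⟩⟩
      have hZset : region Lm (insert (p, q) D) = {L | L ∈ region L₀ D ∧ L.pt q < L.pt p} := by
        ext L
        rw [mem_region_insert, region_eq_of_mem hLm]
        simp only [hm, hm.not_gt, iff_true, iff_false, Set.mem_ofPred_eq]
        exact and_congr_right fun _ => ⟨fun h => h.2, fun h => ⟨h.not_gt, h⟩⟩
      have h₀set : region M (insert (p, q) D) = {L | L ∈ region L₀ D ∧ L.pt p = L.pt q} := by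
        ext L
        rw [mem_region_insert, region_eq_of_mem hM]
        simp only [hMpq, lt_self_iff_false, iff_false, Set.mem_ofPred_eq, not_lt]
        exact and_congr_right fun _ => ⟨fun h => le_antisymm h.2 h.1, fun h => ⟨h.ge, h.le⟩⟩
      have bY := ih' Lp
      have bZ := ih' Lm
      have b₀ := ih' M
      rw [hYset, htight Lp hLp hp.ne] at bY
      rw [hZset, htight Lm hLm hm.ne'] at bZ
      rw [h₀set, htight₀ M hM hMpq] at b₀
      have hspan : ∀ L ∈ {L | L ∈ region L₀ D ∧ L.pt p = L.pt q},
          L.dim + 1 = Module.finrank ℝ (constSub S (tight D L₀.pt)) →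
          ∀ w ∈ constSub S (tight D L₀.pt), w p = w q →
            w ∈ constSub S (tight Set.univ L.pt) := by
        rintro L ⟨hL, hLpq⟩ hdim w hw hwpq
        have hle : constSub S (tight Set.univ L.pt) ≤
            constSub S (insert (p, q) (tight D L₀.pt)) := by
          rw [← htight₀ L hL hLpq]
          exact constSub_anti fun s hs => ⟨trivial, hs.2⟩
        rw [Submodule.eq_of_le_of_finrank_eq hle (by
          have := finrank_constSub_insert hv hvpq
          rw [L.finrank_constSub]
          omega)]
        exact constSub_insert.2 ⟨hw, hwpq⟩
      have hYside : ∀ σ ∈ {L | L ∈ region L₀ D ∧ L.pt p = L.pt q},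
          σ.dim + 1 = Module.finrank ℝ (constSub S (tight D L₀.pt)) →
          ∑ τ, Set.indicator {L | L ∈ region L₀ D ∧ L.pt p < L.pt q} (incidence lam σ) τ = 1 :=
        fun σ hσ hdim => sum_incidence_side hD hσ.1 hσ.2 (hspan σ hσ hdim) hv hlt hdim
      have hZside : ∀ σ ∈ {L | L ∈ region L₀ D ∧ L.pt p = L.pt q},
          σ.dim + 1 = Module.finrank ℝ (constSub S (tight D L₀.pt)) →
          ∑ τ, Set.indicator {L | L ∈ region L₀ D ∧ L.pt q < L.pt p} (incidence lam σ) τ = 1 :=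
        fun σ hσ hdim => sum_incidence_side hD hσ.1 hσ.2.symm
          (fun w hw h => hspan σ hσ hdim w hw h.symm) (neg_mem hv) (neg_lt_neg hlt) hdim
      refine IsBall.glue (inc := incidence lam) (dim := AdmChain.dim)
        (fun σ τ h => (incidence_ne_zero_iff.1 h).2) incidence_mul_self
        (finrank_constSub_insert hv hvpq) (fun σ => ?_) ?_ ?_ ?_ ?_ ?_ ?_ hYside hZside
        bY b₀ bZ
      · simp only [Set.mem_ofPred_eq, ← and_or_left]
        exact (and_iff_left (lt_trichotomy _ _)).symm
      · exact Set.disjoint_left.2 fun σ h h' => h.2.ne h'.2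
      · exact Set.disjoint_left.2 fun σ h h' => h.2.asymm h'.2
      · exact Set.disjoint_left.2 fun σ h h' => h.2.ne' h'.2
      · exact fun σ hσ τ hτ h =>
          ⟨hτ, AdmChain.le_iff.1 (incidence_ne_zero_iff.1 h).1 _ _ hσ.2⟩
      · exact fun σ hσ τ hτ h =>
          ⟨hτ, AdmChain.le_iff.1 (incidence_ne_zero_iff.1 h).1 _ _ hσ.2⟩
      · exact fun σ hσ τ hτ ρ h1 h2 => mem_region_of_between hσ hτ
          (incidence_ne_zero_iff.1 h1).1 (incidence_ne_zero_iff.1 h2).1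
    · have hset : region L₀ (insert (p, q) D) = region L₀ D := by
        refine Set.Subset.antisymm (fun L hL => (mem_region_insert.1 hL).1) fun L hL => ?_
        by_contra h
        exact hcut (exists_cut hD hL h)
      have hsub : constSub S (tight (insert (p, q) D) L₀.pt) = constSub S (tight D L₀.pt) := by
        by_cases he : L₀.pt p = L₀.pt q
        · rw [htight₀ L₀ self_mem_region he]
          ext v
          rw [constSub_insert]
          refine and_iff_left_of_imp fun hv => ?_
          by_contra hne
          exact hcut ⟨⟨L₀, self_mem_region, he⟩, v, hv, hne⟩
        · rw [htight L₀ self_mem_region he]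
      have := ih' L₀
      rwa [hset, hsub] at this

end Region

/-! ### Cells, their faces and their carriers -/

/-- The pairs `(p, q)` with `p ≤ q` in the poset. -/
def lePairs (P : Type*) [PartialOrder P] : Set (P × P) := {s | s.1 ≤ s.2}

theorem orderPolytope_eq {P : Type*} [PartialOrder P] {S : Set P} {lam : S → ℝ} :
    orderPolytope lam = relPolytope lam (lePairs P) := by
  ext x
  exact and_comm

section Cells

variable {P : Type*} [PartialOrder P] [Finite P] {S : Set P} {lam : S → ℝ}

theorem AdmChain.pt_mem_orderPolytope (L : AdmChain lam) : L.pt ∈ relPolytope lam (lePairs P) :=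
  ⟨L.pt_lam, fun _ _ h => L.pt_mono h⟩

theorem AdmChain.mem_chainPolytope {L : AdmChain lam} {x : P → ℝ} :
    x ∈ chainPolytope lam L.1 ↔
      (∀ a : S, x a = lam a) ∧ ∀ p q, L.pt p ≤ L.pt q → x p ≤ x q := by
  rw [mem_chainPolytope_iff]
  simp only [L.lt_iff, not_lt]

theorem AdmChain.chainPolytope_eq (L : AdmChain lam) :
    chainPolytope lam L.1 = relPolytope lam {s | L.pt s.1 ≤ L.pt s.2} := by
  ext x
  exact L.mem_chainPolytope

theorem AdmChain.pt_mem (L : AdmChain lam) : L.pt ∈ chainPolytope lam L.1 :=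
  L.mem_chainPolytope.2 ⟨L.pt_lam, fun _ _ h => h⟩

theorem AdmChain.eq_of_mem {L : AdmChain lam} {x : P → ℝ} (hx : x ∈ chainPolytope lam L.1) {p q : P}
    (h : L.pt p = L.pt q) : x p = x q :=
  le_antisymm ((L.mem_chainPolytope.1 hx).2 p q h.le) ((L.mem_chainPolytope.1 hx).2 q p h.ge)

theorem AdmChain.isFace_iff {L L' : AdmChain lam} :
    IsFace (chainPolytope lam L'.1) (chainPolytope lam L.1) ↔ L ≤ L' := by
  constructor
  · intro h
    have := L'.mem_chainPolytope.1 (h.2.subset L.pt_mem)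
    refine AdmChain.le_iff.2 fun p q hpq => ?_
    by_contra hc
    exact hpq.not_ge (this.2 q p (not_lt.1 hc))
  · intro h
    have hle : ∀ p q, L'.pt p ≤ L'.pt q → L.pt p ≤ L.pt q := fun p q hpq =>
      not_lt.1 fun hc => hpq.not_gt (AdmChain.le_iff.1 h q p hc)
    rw [L'.chainPolytope_eq]
    have : chainPolytope lam L.1 = tightFace lam {s | L'.pt s.1 ≤ L'.pt s.2} L.pt := by
      ext x
      constructor
      · intro hx
        exact ⟨⟨(L.mem_chainPolytope.1 hx).1, fun p q hpq =>
          (L.mem_chainPolytope.1 hx).2 p q (hle p q hpq)⟩, fun p q _ h => L.eq_of_mem hx h⟩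
      · rintro ⟨⟨hx0, hx1⟩, hx2⟩
        refine L.mem_chainPolytope.2 ⟨hx0, fun p q hpq => ?_⟩
        rcases hpq.lt_or_eq with h1 | h1
        · exact hx1 p q (AdmChain.le_iff.1 h p q h1).le
        · rcases le_total (L'.pt p) (L'.pt q) with h2 | h2
          · exact (hx2 p q h2 h1).le
          · exact (hx2 q p h2 h1.symm).ge
    rw [this]
    exact isFace_tightFace ⟨L.pt_lam, hle⟩

theorem chainPolytope_injective :
    Function.Injective fun L : AdmChain lam => chainPolytope lam L.1 := by
  intro L L' (h : chainPolytope lam L.1 = chainPolytope lam L'.1)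
  have h1 := AdmChain.isFace_iff.2 (le_refl L)
  have h2 := AdmChain.isFace_iff.2 (le_refl L')
  exact le_antisymm (AdmChain.isFace_iff.1 (h ▸ h1)) (AdmChain.isFace_iff.1 (h ▸ h2))

theorem AdmChain.polyDim_chainPolytope (L : AdmChain lam) :
    polyDim (chainPolytope lam L.1) = L.dim := by
  have h1 : chainPolytope lam L.1 = tightFace lam {s | L.pt s.1 ≤ L.pt s.2} L.pt := by
    rw [L.chainPolytope_eq]
    ext x
    refine ⟨fun hx => ⟨hx, fun p q _ h => ?_⟩, fun hx => hx.1⟩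
    exact L.eq_of_mem (L.chainPolytope_eq ▸ hx) h
  have h2 : tight {s | L.pt s.1 ≤ L.pt s.2} L.pt = tight Set.univ L.pt := by
    ext ⟨p, q⟩
    exact ⟨fun h => ⟨trivial, h.2⟩, fun h => ⟨h.2.le, h.2⟩⟩
  have h3 := L.pt_mem
  rw [L.chainPolytope_eq] at h3
  rw [h1, polyDim_tightFace h3, h2, L.finrank_constSub]

/-- The carrier of `F_L`: the smallest face of the marked order polytope containing it. -/
def AdmChain.carrier (L : AdmChain lam) : Set (P → ℝ) := tightFace lam (lePairs P) L.pt

theorem AdmChain.isFace_carrier (L : AdmChain lam) : IsFace (orderPolytope lam) L.carrier := by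
  rw [orderPolytope_eq]
  exact isFace_tightFace L.pt_mem_orderPolytope

theorem isFace_orderPolytope_iff {A : Set (P → ℝ)} :
    IsFace (orderPolytope lam) A ↔ ∃ L : AdmChain lam, L.carrier = A := by
  constructor
  · rw [orderPolytope_eq, isFace_relPolytope_iff]
    rintro ⟨z, hz, rfl⟩
    obtain ⟨L, hL⟩ := exists_admChain (lam := lam) (x := z) (fun p q h => hz.2 p q h) hz.1
    have heq : ∀ p q, L.pt p = L.pt q ↔ z p = z q := by
      intro p q
      rw [le_antisymm_iff, le_antisymm_iff, ← not_lt, ← not_lt, hL, hL, not_lt, not_lt]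
    refine ⟨L, ?_⟩
    ext x
    simp only [AdmChain.carrier, tightFace, Set.mem_ofPred_eq, heq]
  · rintro ⟨L, rfl⟩
    exact L.isFace_carrier

theorem AdmChain.polyDim_carrier (L : AdmChain lam) :
    polyDim L.carrier = Module.finrank ℝ (constSub S (tight (lePairs P) L.pt)) :=
  polyDim_tightFace L.pt_mem_orderPolytope

theorem AdmChain.mem_region_lePairs {L L' : AdmChain lam} :
    L ∈ region L' (lePairs P) ↔ ∀ p q, p ≤ q → (L.pt p = L.pt q ↔ L'.pt p = L'.pt q) := by
  refine ⟨fun h p q hpq => eq_iff_of_mem_region h hpq, fun h p q hpq => ⟨?_, ?_⟩⟩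
  · rw [(L.pt_mono hpq).lt_iff_ne, (L'.pt_mono hpq).lt_iff_ne, ne_eq, ne_eq, h p q hpq]
  · exact iff_of_false (L.pt_mono hpq).not_gt (L'.pt_mono hpq).not_gt

theorem AdmChain.carrier_eq_iff {L L' : AdmChain lam} :
    L.carrier = L'.carrier ↔ L ∈ region L' (lePairs P) := by
  rw [AdmChain.mem_region_lePairs]
  constructor
  · intro h p q hpq
    have h1 : L.pt ∈ L'.carrier := h ▸ self_mem_tightFace L.pt_mem_orderPolytope
    have h2 : L'.pt ∈ L.carrier := h ▸ self_mem_tightFace L'.pt_mem_orderPolytope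
    exact ⟨h2.2 p q hpq, h1.2 p q hpq⟩
  · intro h
    ext x
    refine and_congr_right fun _ => forall_congr' fun p => forall_congr' fun q =>
      forall_congr' fun hpq => ?_
    rw [h p q hpq]

/-- The cell of `L` is a cell of the face `A` relative to its boundary if and only if `A` is the
carrier of `L`. -/
theorem AdmChain.carrier_eq_iff_subset {L : AdmChain lam} {A : Set (P → ℝ)}
    (hA : IsFace (orderPolytope lam) A) :
    L.carrier = A ↔ chainPolytope lam L.1 ⊆ A ∧
      ¬ chainPolytope lam L.1 ⊆ intrinsicFrontier ℝ A := by
  constructor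
  · rintro rfl
    constructor
    · intro x hx
      refine ⟨⟨(L.mem_chainPolytope.1 hx).1, fun p q h =>
        (L.mem_chainPolytope.1 hx).2 p q (L.pt_mono h)⟩, fun p q _ h => L.eq_of_mem hx h⟩
    · intro h
      obtain ⟨p, q, -, h1, h2⟩ := (mem_intrinsicFrontier_tightFace L.pt_mem_orderPolytope
        (self_mem_tightFace L.pt_mem_orderPolytope)).1 (h L.pt_mem)
      exact h2 h1
  · obtain ⟨L', rfl⟩ := isFace_orderPolytope_iff.1 hA
    rintro ⟨h1, h2⟩
    rw [AdmChain.carrier_eq_iff, AdmChain.mem_region_lePairs]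
    refine fun p q hpq => ⟨fun h => ?_, (h1 L.pt_mem).2 p q hpq⟩
    by_contra hne
    exact h2 fun x hx => (mem_intrinsicFrontier_tightFace L'.pt_mem_orderPolytope (h1 hx)).2
      ⟨p, q, hpq, L.eq_of_mem hx h, hne⟩

end Cells

/-! ### Conjugate condensations preserve the carrier -/

section Conjugate

variable {P : Type*} [PartialOrder P] {S : Set P} {lam : S → ℝ}

theorem mem_gap {I J : LowerSet P} {p : P} : p ∈ gap I J ↔ p ∈ J ∧ p ∉ I := Iff.rfl

theorem IsCondensation.not_mem {L L' : AdmChain lam} {I K J : LowerSet P}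
    (h : IsCondensation L I K J L') : J ∉ L.1.ideals :=
  fun hJ => h.1.2.2.2 J hJ ⟨h.2.1, h.2.2.1⟩

theorem IsCondensation.le {L L' : AdmChain lam} {I K J : LowerSet P}
    (h : IsCondensation L I K J L') : L ≤ L' := by
  classical
  rw [AdmChain.le_def, h.2.2.2]
  exact Finset.subset_insert _ _

/-- The position at which an ideal is added is determined by the condensed chain. -/
theorem IsCondensation.unique {L L' : AdmChain lam} {I K J I' K' J' : LowerSet P}
    (h : IsCondensation L I K J L') (h' : IsCondensation L I' K' J' L') : K = K' := by
  classical
  have hJ : J = J' := by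
    have h1 : J ∈ insert J' L.1.ideals := by
      rw [← h'.2.2.2, h.2.2.2]
      exact Finset.mem_insert_self _ _
    exact (Finset.mem_insert.1 h1).resolve_right h.not_mem
  subst hJ
  obtain ⟨⟨-, hK, -, hno⟩, hIJ, hJK, -⟩ := h
  obtain ⟨⟨-, hK', -, hno'⟩, hIJ', hJK', -⟩ := h'
  rcases L.1.isChain.total hK hK' with h | h
  · by_contra hne
    exact hno' K hK ⟨hIJ'.trans hJK, lt_of_le_of_ne h hne⟩
  · by_contra hne
    exact hno K' hK' ⟨hIJ.trans hJK', lt_of_le_of_ne h (Ne.symm hne)⟩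

theorem HasConjugate.carrier_eq [Finite P] {L L' : AdmChain lam} {K : LowerSet P}
    (h : HasConjugate L K L') : L.carrier = L'.carrier := by
  classical
  obtain ⟨I, J, hc, J', L'', hc', hg1, hg2⟩ := h
  rw [AdmChain.carrier_eq_iff]
  have hlt : ∀ p q, p ≤ q → L'.1.Lt p q → L.1.Lt p q := by
    rintro p q hpq ⟨M, hM, hpM, hqM⟩
    rw [hc.2.2.2, Finset.mem_insert] at hM
    rcases hM with rfl | hM
    · by_cases hpI : p ∈ I
      · exact ⟨I, hc.1.1, hpI, fun h => hqM (hc.2.1.le h)⟩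
      by_cases hqK : q ∈ K
      · have hp : p ∈ gap J' K := hg2 ▸ mem_gap.2 ⟨hpM, hpI⟩
        have hq : q ∈ gap I J' := hg1 ▸ mem_gap.2 ⟨hqK, hqM⟩
        exact absurd (J'.lower hpq hq.1) hp.2
      · exact ⟨K, hc.1.2.1, hc.2.2.1.le hpM, hqK⟩
    · exact ⟨M, hM, hpM, hqM⟩
  intro p q hpq
  refine ⟨⟨AdmChain.le_iff.1 hc.le p q, fun h => ?_⟩,
    iff_of_false (L.pt_mono hpq).not_gt (L'.pt_mono hpq).not_gt⟩
  rw [← AdmChain.lt_iff] at h ⊢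
  exact hlt p q hpq h

/-- If `J \ I` and `K \ J` are incomparable, then the part `K \ J` can be adjoined first. -/
theorem IsCondensation.hasConjugate [Finite P] {L L' : AdmChain lam} {I K J : LowerSet P}
    (hc : IsCondensation L I K J L') (hcar : L.carrier = L'.carrier) : HasConjugate L K L' := by
  classical
  have hreg := AdmChain.carrier_eq_iff.1 hcar
  have hIJ := hc.2.1
  have hJK := hc.2.2.1
  have hL'J : ∀ p q, p ∈ J → q ∉ J → L'.1.Lt p q := fun p q hp hq =>
    ⟨J, by rw [hc.2.2.2]; exact Finset.mem_insert_self _ _, hp, hq⟩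
  have hnot : ∀ p q, p ∈ gap I K → q ∈ gap I K → ¬ L.1.Lt p q := fun p q hp hq =>
    hc.1.not_lt hp hq
  let J' : LowerSet P :=
    { carrier := {q | q ∈ I ∨ (q ∈ K ∧ q ∉ J)}
      lower' := by
        rintro q p hpq (hq | ⟨hqK, hqJ⟩)
        · exact Or.inl (I.lower hpq hq)
        · have hpK := K.lower hpq hqK
          by_cases hpJ : p ∈ J
          · by_contra hp
            have hpI : p ∉ I := fun h => hp (Or.inl h)
            have h1 := hL'J p q hpJ hqJ
            rw [L'.lt_iff, ← (hreg p q hpq).1, ← L.lt_iff] at h1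
            exact hnot p q ⟨hpK, hpI⟩ ⟨hqK, fun h => hqJ (hIJ.le h)⟩ h1
          · exact Or.inr ⟨hpK, hpJ⟩ }
  have hmem : ∀ q, q ∈ J' ↔ q ∈ I ∨ (q ∈ K ∧ q ∉ J) := fun q => Iff.rfl
  obtain ⟨a, haJ, haI⟩ := Set.not_subset.1 hIJ.not_ge
  obtain ⟨b, hbK, hbJ⟩ := Set.not_subset.1 hJK.not_ge
  have hIJ' : I < J' := lt_of_le_of_ne (fun q hq => Or.inl hq) fun e => by
    have : b ∈ I := by rw [e]; exact Or.inr ⟨hbK, hbJ⟩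
    exact hbJ (hIJ.le this)
  have hJ'K : J' < K := lt_of_le_of_ne (fun q hq => hq.elim
    (fun h => (hIJ.trans hJK).le h) fun h => h.1) fun e => by
    have : a ∈ J' := by rw [e]; exact hJK.le haJ
    exact this.elim haI fun h => h.2 haJ
  have hcmp : ∀ M ∈ L.1.ideals, M ≤ J' ∨ J' ≤ M := by
    intro M hM
    rcases L.1.isChain.total hM hc.1.1 with h | h
    · exact Or.inl (h.trans hIJ'.le)
    rcases L.1.isChain.total hM hc.1.2.1 with h' | h'
    · by_cases e : I = M
      · exact Or.inl (e ▸ hIJ'.le)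
      · by_cases e' : M = K
        · exact Or.inr (e' ▸ hJ'K.le)
        · exact absurd ⟨lt_of_le_of_ne h e, lt_of_le_of_ne h' e'⟩ (hc.1.2.2.2 M hM)
    · exact Or.inr (hJ'K.le.trans h')
  let N : IdealChain P :=
    { ideals := insert J' L.1.ideals
      bot_mem := Finset.mem_insert_of_mem L.1.bot_mem
      top_mem := Finset.mem_insert_of_mem L.1.top_mem
      isChain := by
        rw [Finset.coe_insert]
        exact L.1.isChain.insert fun M hM _ => (hcmp M hM).symm }
  have hN : N.IsAdmissible lam := by
    refine IdealChain.isAdmissible_iff.2 fun x y => ⟨?_, fun h => ?_⟩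
    · rintro ⟨M, hM, hxM, hyM⟩
      rcases Finset.mem_insert.1 hM with rfl | hM
      · by_cases hyK : (y : P) ∈ K
        · rcases hxM with hxI | ⟨hxK, hxJ⟩
          · exact (L.lt_iff_lam x y).1 ⟨I, hc.1.1, hxI, fun h => hyM (Or.inl h)⟩
          · -- Otherwise both parts contain marked elements, against admissibility of `L'`.
            have hyJ : (y : P) ∈ J := by
              by_contra h
              exact hyM (Or.inr ⟨hyK, h⟩)
            have h1 := (L'.lt_iff_lam y x).1 (hL'J y x hyJ hxJ)
            exact absurd ((L.lt_iff_lam y x).2 h1) (hnot y x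
              ⟨hyK, fun h => hyM (Or.inl h)⟩ ⟨hxK, fun h => hxJ (hIJ.le h)⟩)
        · exact (L.lt_iff_lam x y).1 ⟨K, hc.1.2.1, hJ'K.le hxM, hyK⟩
      · exact (L.lt_iff_lam x y).1 ⟨M, hM, hxM, hyM⟩
    · obtain ⟨M, hM, h1⟩ := (L.lt_iff_lam x y).2 h
      exact ⟨M, Finset.mem_insert_of_mem hM, h1⟩
  have hIle : ∀ q, q ∈ I → q ∈ J := fun q h => hIJ.le h
  have hJle : ∀ q, q ∈ J → q ∈ K := fun q h => hJK.le h
  refine ⟨I, J, hc, J', ⟨N, hN⟩, ⟨hc.1, hIJ', hJ'K, ?_⟩, ?_, ?_⟩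
  · change insert J' L.1.ideals = _
    congr!
  · ext q
    have := hIle q
    simp only [mem_gap, hmem]
    tauto
  · ext q
    have := hIle q
    have := hJle q
    simp only [mem_gap, hmem]
    tauto

theorem HasConjugate.le [Finite P] {L L' : AdmChain lam} {K : LowerSet P}
    (h : HasConjugate L K L') : L ≤ L' := by
  obtain ⟨I, J, hc, -⟩ := h
  exact hc.le

end Conjugate

/-! ### The differential of the chain complex -/

section Extension

variable {P : Type*} [PartialOrder P] {S : Set P} {lam : S → ℝ}

open Classical in
/-- Extension by zero of a homogeneous cochain to a function on all chains. -/
noncomputable def extend {n : ℕ} (c : ChainCochain lam n) (L : AdmChain lam) : ZMod 2 :=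
  if h : L.dim = n then c ⟨L, h⟩ else 0

theorem extend_apply {n : ℕ} (c : ChainCochain lam n) (L : {L : AdmChain lam // L.dim = n}) :
    extend c L.1 = c L := by
  simp [extend, L.2]

theorem extend_ne_zero {n : ℕ} {c : ChainCochain lam n} {L : AdmChain lam} (h : extend c L ≠ 0) :
    L.dim = n := by
  by_contra hn
  exact h (dif_neg hn)

theorem extend_injective {n : ℕ} : Function.Injective (extend (lam := lam) (n := n)) := by
  intro c c' h
  ext L
  rw [← extend_apply, ← extend_apply, h]

end Extension

section Differential

open Matrix

variable {P : Type*} [PartialOrder P] [Finite P] {S : Set P} {lam : S → ℝ}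

variable (lam) in
open Classical in
/-- The incidence matrix of `⨁_A C^*(𝒜', ∂𝒜')`: only incidences between cells with the same carrier
are kept. -/
noncomputable def carrierIncidence : Matrix (AdmChain lam) (AdmChain lam) (ZMod 2) :=
  Matrix.of fun L L' => if L.carrier = L'.carrier then incidence lam L L' else 0

theorem carrierIncidence_of_eq {L L' : AdmChain lam} (h : L.carrier = L'.carrier) :
    carrierIncidence lam L L' = incidence lam L L' := by
  simp only [carrierIncidence, of_apply, h]
  simp

theorem carrierIncidence_of_ne {L L' : AdmChain lam} (h : L.carrier ≠ L'.carrier) :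
    carrierIncidence lam L L' = 0 := by
  simp only [carrierIncidence, of_apply]
  exact if_neg h

theorem carrierIncidence_ne_zero_iff {L L' : AdmChain lam} :
    carrierIncidence lam L L' ≠ 0 ↔
      L.carrier = L'.carrier ∧ L ≤ L' ∧ L'.dim = L.dim + 1 := by
  rw [← incidence_ne_zero_iff]
  by_cases h : L.carrier = L'.carrier
  · simp [carrierIncidence_of_eq h, h]
  · simp [carrierIncidence_of_ne h, h]

theorem zmod_two_eq_one {a : ZMod 2} (h : a ≠ 0) : a = 1 := by
  revert a
  decide

theorem carrierIncidence_mul_self : carrierIncidence lam * carrierIncidence lam = 0 := by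
  ext L L'
  rw [mul_apply, Matrix.zero_apply]
  by_cases hc : L.carrier = L'.carrier
  · have h0 := congrFun (congrFun (incidence_mul_self (lam := lam)) L) L'
    rw [mul_apply, Matrix.zero_apply] at h0
    rw [← h0]
    refine Finset.sum_congr rfl fun M _ => ?_
    by_cases hM : M.carrier = L'.carrier
    · rw [carrierIncidence_of_eq (hc.trans hM.symm), carrierIncidence_of_eq hM]
    · rw [carrierIncidence_of_ne hM, mul_zero]
      by_contra hne
      refine hM (AdmChain.carrier_eq_iff.2 (mem_region_of_between
        (AdmChain.carrier_eq_iff.1 hc) self_mem_region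
        (incidence_ne_zero_iff.1 (left_ne_zero_of_mul (Ne.symm hne))).1
        (incidence_ne_zero_iff.1 (right_ne_zero_of_mul (Ne.symm hne))).1))
  · refine Finset.sum_eq_zero fun M _ => ?_
    by_contra hne
    exact hc ((carrierIncidence_ne_zero_iff.1 (left_ne_zero_of_mul hne)).1.trans
      (carrierIncidence_ne_zero_iff.1 (right_ne_zero_of_mul hne)).1)

theorem exists_extend_eq {n : ℕ} {z : AdmChain lam → ZMod 2} (h : ∀ L, z L ≠ 0 → L.dim = n) :
    ∃ c : ChainCochain lam n, extend c = z := by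
  refine ⟨Finsupp.equivFunOnFinite.symm fun L => z L.1, funext fun L => ?_⟩
  by_cases hL : L.dim = n
  · exact extend_apply _ ⟨L, hL⟩
  · rw [extend, dif_neg hL]
    by_contra hz
    exact hL (h L (Ne.symm hz))

theorem sum_extend {n : ℕ} (c : ChainCochain lam n) (f : AdmChain lam → ZMod 2) :
    ∑ L, extend c L * f L = ∑ L : {L : AdmChain lam // L.dim = n}, c L * f L.1 := by
  symm
  refine Fintype.sum_of_injective Subtype.val Subtype.val_injective _ _ (fun L hL => ?_)
    fun L => by rw [extend_apply]
  rw [extend, dif_neg fun h => hL ⟨⟨L, h⟩, rfl⟩, zero_mul]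

open Classical in
theorem conjugateSum_apply {n : ℕ} (L : {L : AdmChain lam // L.dim = n}) (K : LowerSet P)
    (L' : {L : AdmChain lam // L.dim = n + 1}) :
    conjugateSum lam L K L' = if HasConjugate L.1 K L'.1 then 1 else 0 := by
  rw [conjugateSum, Finsupp.finsetSum_apply]
  by_cases h : HasConjugate L.1 K L'.1
  · rw [if_pos h, Finset.sum_eq_single ⟨L'.1, h⟩]
    · simp
    · intro M _ hM
      refine Finsupp.single_eq_of_ne' fun e => hM ?_
      exact Subtype.ext (show M.1 = L'.1 from congrArg (fun N => N.1) e)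
    · simp
  · rw [if_neg h]
    refine Finset.sum_eq_zero fun M _ => Finsupp.single_eq_of_ne' fun e => h ?_
    have : M.1 = L'.1 := congrArg Subtype.val e
    exact this ▸ M.2

theorem sum_conjugateSum_apply {n : ℕ} (L : {L : AdmChain lam // L.dim = n})
    (L' : {L : AdmChain lam // L.dim = n + 1}) :
    (∑ K ∈ L.1.1.ideals, conjugateSum lam L K) L' = carrierIncidence lam L.1 L'.1 := by
  classical
  rw [Finsupp.finsetSum_apply]
  simp only [conjugateSum_apply]
  by_cases hex : ∃ K, HasConjugate L.1 K L'.1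
  · obtain ⟨K, hK⟩ := hex
    obtain ⟨I, J, hc, -⟩ := id hK
    rw [Finset.sum_eq_single K, if_pos hK]
    · exact (zmod_two_eq_one (carrierIncidence_ne_zero_iff.2
        ⟨hK.carrier_eq, hK.le, by rw [L.2, L'.2]⟩)).symm
    · intro K' _ hne
      rw [if_neg]
      rintro ⟨I', J', hc', -⟩
      exact hne (hc'.unique hc)
    · exact fun h => absurd hc.1.2.1 h
  · rw [Finset.sum_eq_zero fun K _ => if_neg fun h => hex ⟨K, h⟩]
    by_contra hne
    obtain ⟨h1, h2, h3⟩ := carrierIncidence_ne_zero_iff.1 (Ne.symm hne)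
    obtain ⟨I, K, J, hc⟩ := AdmChain.exists_isCondensation_of_le h2 h3
    exact hex ⟨K, hc.hasConjugate h1⟩

theorem chainCoboundary_apply {n : ℕ} (c : ChainCochain lam n)
    (L' : {L : AdmChain lam // L.dim = n + 1}) :
    chainCoboundary lam n c L' =
      ∑ L : {L : AdmChain lam // L.dim = n}, c L * carrierIncidence lam L.1 L'.1 := by
  rw [chainCoboundary, Finsupp.linearCombination_apply, Finsupp.sum_fintype _ _ (by simp),
    Finsupp.finsetSum_apply]
  refine Finset.sum_congr rfl fun L _ => ?_
  rw [Finsupp.smul_apply, sum_conjugateSum_apply, smul_eq_mul]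

/-- The differential `δ` is the coboundary of the carrier preserving incidences. -/
theorem extend_chainCoboundary {n : ℕ} (c : ChainCochain lam n) :
    extend (chainCoboundary lam n c) = extend c ᵥ* carrierIncidence lam := by
  funext L'
  by_cases hL' : L'.dim = n + 1
  · rw [extend_apply _ ⟨L', hL'⟩, chainCoboundary_apply]
    exact (sum_extend c fun L => carrierIncidence lam L L').symm
  · rw [extend, dif_neg hL']
    refine (vecMul_apply_eq_zero fun L hL => ?_).symm
    by_contra hne
    exact hL' (by rw [(carrierIncidence_ne_zero_iff.1 hne).2.2, extend_ne_zero hL])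

theorem chainCoboundary_comp (n : ℕ) :
    chainCoboundary lam (n + 1) ∘ₗ chainCoboundary lam n = 0 := by
  refine LinearMap.ext fun c => extend_injective ?_
  rw [LinearMap.comp_apply, extend_chainCoboundary, extend_chainCoboundary, vecMul_vecMul,
    carrierIncidence_mul_self, vecMul_zero]
  funext L
  simp [extend]

end Differential

/-! ### The isomorphism with the complex of the subdivision -/

section Iso

variable {P : Type*} [PartialOrder P] [Finite P] {S : Set P} {lam : S → ℝ}

variable (lam) in
/-- The cells of the pair `(𝒜', ∂𝒜')` for a face `A`. -/
abbrev FaceCell (n : ℕ) (A : {A : Set (P → ℝ) // IsFace (orderPolytope lam) A}) : Type _ :=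
  RelCell (subcomplexIn (cubosimplicial lam) A.1) (subcomplexBoundary (cubosimplicial lam) A.1) n

theorem relCell_iff {A : Set (P → ℝ)} (hA : IsFace (orderPolytope lam) A) {n : ℕ}
    {Q : Set (P → ℝ)} :
    (Q ∈ subcomplexIn (cubosimplicial lam) A ∧
      Q ∉ subcomplexBoundary (cubosimplicial lam) A ∧ polyDim Q = n) ↔
    ∃ L : AdmChain lam, chainPolytope lam L.1 = Q ∧ L.carrier = A ∧ L.dim = n := by
  simp only [subcomplexBoundary, subcomplexIn, cubosimplicial, Finset.mem_filter, Finset.mem_image,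
    Finset.mem_univ, true_and, not_and]
  constructor
  · rintro ⟨⟨⟨L, rfl⟩, h1⟩, h2, h3⟩
    exact ⟨L, rfl, (AdmChain.carrier_eq_iff_subset hA).2 ⟨h1, h2 ⟨⟨L, rfl⟩, h1⟩⟩,
      L.polyDim_chainPolytope ▸ h3⟩
  · rintro ⟨L, rfl, h1, h2⟩
    obtain ⟨h3, h4⟩ := (AdmChain.carrier_eq_iff_subset hA).1 h1
    exact ⟨⟨⟨L, rfl⟩, h3⟩, fun _ => h4, L.polyDim_chainPolytope.trans h2⟩

variable (lam) in
/-- The cell `F_L`, as a cell of the carrier of `L` relative to its boundary. -/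
def toFaceCell (n : ℕ) (L : {L : AdmChain lam // L.dim = n}) : Σ A, FaceCell lam n A :=
  ⟨⟨L.1.carrier, L.1.isFace_carrier⟩, ⟨chainPolytope lam L.1.1,
    (relCell_iff L.1.isFace_carrier).2 ⟨L.1, rfl, rfl, L.2⟩⟩⟩

theorem toFaceCell_bijective (n : ℕ) : Function.Bijective (toFaceCell lam n) := by
  constructor
  · intro L L' h
    have : chainPolytope lam L.1.1 = chainPolytope lam L'.1.1 :=
      congrArg (fun s : Σ A, FaceCell lam n A => s.2.1) h
    exact Subtype.ext (chainPolytope_injective this)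
  · rintro ⟨⟨A, hA⟩, ⟨Q, hQ⟩⟩
    obtain ⟨L, rfl, rfl, rfl⟩ := (relCell_iff hA).1 hQ
    exact ⟨⟨L, rfl⟩, rfl⟩

variable (lam) in
/-- Each admissible chain of dimension `n` is an `n`-cell of exactly one face. -/
noncomputable def faceCellEquiv (n : ℕ) :
    {L : AdmChain lam // L.dim = n} ≃ Σ A, FaceCell lam n A :=
  Equiv.ofBijective (toFaceCell lam n) (toFaceCell_bijective n)

theorem faceCellEquiv_symm {n : ℕ} (s : Σ A, FaceCell lam n A) :
    ((faceCellEquiv lam n).symm s).1.carrier = s.1.1 ∧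
      chainPolytope lam ((faceCellEquiv lam n).symm s).1.1 = s.2.1 := by
  obtain ⟨L, rfl⟩ := (faceCellEquiv lam n).surjective s
  rw [Equiv.symm_apply_apply]
  exact ⟨rfl, rfl⟩

variable (lam) in
open Classical in
/-- The isomorphism that identifies a chain `L` with the cell `F_L`. -/
noncomputable def cochainEquiv (n : ℕ) :
    ChainCochain lam n ≃ₗ[ZMod 2] SubdivCochain (orderPolytope lam) (cubosimplicial lam) n :=
  (Finsupp.domLCongr (faceCellEquiv lam n) ≪≫ₗ sigmaFinsuppLequivDFinsupp (ZMod 2)) ≪≫ₗ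
    DFinsupp.mapRange.linearEquiv fun A =>
      Finsupp.linearEquivFunOnFinite (ZMod 2) (ZMod 2) (FaceCell lam n A)

theorem cochainEquiv_apply {n : ℕ} (c : ChainCochain lam n)
    (A : {A : Set (P → ℝ) // IsFace (orderPolytope lam) A}) (Q : FaceCell lam n A) :
    cochainEquiv lam n c A Q = c ((faceCellEquiv lam n).symm ⟨A, Q⟩) := by
  rfl

theorem cochainEquiv_chainCoboundary (n : ℕ) (c : ChainCochain lam n) :
    cochainEquiv lam (n + 1) (chainCoboundary lam n c) =
      subdivCoboundary (orderPolytope lam) (cubosimplicial lam) n (cochainEquiv lam n c) := by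
  classical
  refine DFinsupp.ext fun A => funext fun Q => ?_
  have hR : subdivCoboundary (orderPolytope lam) (cubosimplicial lam) n (cochainEquiv lam n c) A Q =
      ∑ R : FaceCell lam n A, if IsFace Q.1 R.1 then cochainEquiv lam n c A R else 0 := rfl
  refine Eq.trans ?_ hR.symm
  refine (cochainEquiv_apply _ A Q).trans ?_
  rw [chainCoboundary_apply]
  set L' := (faceCellEquiv lam (n + 1)).symm ⟨A, Q⟩ with hL'
  obtain ⟨h1, h2⟩ := faceCellEquiv_symm (⟨A, Q⟩ : Σ A, FaceCell lam (n + 1) A)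
  symm
  refine Fintype.sum_of_injective (fun R => (faceCellEquiv lam n).symm ⟨A, R⟩) ?_ _ _ ?_ ?_
  · intro R R' h
    simpa using h
  · intro L hL
    obtain ⟨⟨A', R⟩, rfl⟩ := (faceCellEquiv lam n).symm.surjective L
    rw [carrierIncidence_of_ne, mul_zero]
    rw [h1, (faceCellEquiv_symm _).1]
    intro h
    obtain rfl : A' = A := Subtype.ext h
    exact hL ⟨R, rfl⟩
  · intro R
    obtain ⟨h3, h4⟩ := faceCellEquiv_symm (⟨A, R⟩ : Σ A, FaceCell lam n A)
    have hface : IsFace Q.1 R.1 ↔ ((faceCellEquiv lam n).symm ⟨A, R⟩).1 ≤ L'.1 := by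
      rw [← AdmChain.isFace_iff, h4, h2]
    change (if IsFace Q.1 R.1 then c ((faceCellEquiv lam n).symm ⟨A, R⟩) else 0) =
      c ((faceCellEquiv lam n).symm ⟨A, R⟩) *
        carrierIncidence lam ((faceCellEquiv lam n).symm ⟨A, R⟩).1 L'.1
    rw [carrierIncidence_of_eq (h3.trans h1.symm)]
    by_cases h : IsFace Q.1 R.1
    · rw [if_pos h, incidence_eq_one ⟨hface.1 h, by
        rw [L'.2, ((faceCellEquiv lam n).symm ⟨A, R⟩).2]⟩, mul_one]
    · rw [if_neg h]
      by_contra hne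
      exact h (hface.2 (incidence_ne_zero_iff.1 (right_ne_zero_of_mul (Ne.symm hne))).1)

end Iso

/-! ### Cohomology -/

section Cohomology

open Matrix

theorem IsBall.congr {ι : Type*} [Fintype ι] {inc inc' : Matrix ι ι (ZMod 2)} {dim : ι → ℕ}
    {X : Set ι} {d : ℕ} (b : IsBall inc dim X d) (h : ∀ σ ∈ X, ∀ τ ∈ X, inc' σ τ = inc σ τ) :
    IsBall inc' dim X d := by
  have hvec : ∀ z : ι → ZMod 2, (∀ σ, z σ ≠ 0 → σ ∈ X) → ∀ τ ∈ X,
      (z ᵥ* inc') τ = (z ᵥ* inc) τ := by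
    intro z hz τ hτ
    refine Finset.sum_congr rfl fun σ _ => ?_
    by_cases hσ : z σ = 0
    · simp [hσ]
    · exact congrArg (z σ * ·) (h σ (hz σ hσ) τ hτ)
  refine ⟨b.dim_le, b.exists_top, fun σ hσ hd => ?_, fun n z hz hc hs => ?_⟩
  · rw [← b.even σ hσ hd]
    refine Finset.sum_congr rfl fun τ _ => ?_
    by_cases hτ : τ ∈ X
    · rw [Set.indicator_of_mem hτ, Set.indicator_of_mem hτ, h σ hσ τ hτ]
    · rw [Set.indicator_of_notMem hτ, Set.indicator_of_notMem hτ]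
  · obtain ⟨w, hw, hwz⟩ := b.exact n z hz
      (fun τ hτ => (hvec z (fun σ hσ => (hz σ hσ).1) τ hτ).symm.trans (hc τ hτ)) hs
    exact ⟨w, hw, fun τ hτ => (hvec w (fun σ hσ => (hw σ hσ).1) τ hτ).trans (hwz τ hτ)⟩

variable {P : Type*} [PartialOrder P] [Finite P] {S : Set P} {lam : S → ℝ}

/-- The cells whose carrier is a given face form a ball. -/
theorem isBall_face {A : Set (P → ℝ)} (hA : IsFace (orderPolytope lam) A) :
    IsBall (carrierIncidence lam) AdmChain.dim {L | L.carrier = A} (polyDim A) := by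
  obtain ⟨L₀, rfl⟩ := isFace_orderPolytope_iff.1 hA
  have h : {L : AdmChain lam | L.carrier = L₀.carrier} = region L₀ (lePairs P) :=
    Set.ext fun L => AdmChain.carrier_eq_iff
  have b := isBall_region (D := lePairs P) (fun _ _ h => h) L₀
  rw [← h, ← L₀.polyDim_carrier] at b
  exact b.congr fun σ hσ τ hτ => carrierIncidence_of_eq (Eq.trans hσ (Eq.symm hτ))

variable (lam) in
/-- The faces of dimension `n` of the marked order polytope. -/
abbrev FaceOfDim (n : ℕ) : Type _ :=
  {A : Set (P → ℝ) // IsFace (orderPolytope lam) A ∧ polyDim A = n}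

instance (n : ℕ) : Finite (FaceOfDim lam n) := by
  refine Set.Finite.subset (Set.finite_range fun L : AdmChain lam => L.carrier) ?_
  rintro A ⟨hA, -⟩
  exact isFace_orderPolytope_iff.1 hA

variable (lam) in
open Classical in
/-- The augmentation: for each `n`-dimensional face, the sum of the coefficients of the `n`-cells
carried by it. -/
noncomputable def faceSum (n : ℕ) : ChainCochain lam n →ₗ[ZMod 2] (FaceOfDim lam n → ZMod 2) where
  toFun c := fun A => ∑ L : {L : AdmChain lam // L.dim = n}, if L.1.carrier = A.1 then c L else 0
  map_add' c c' := by
    funext A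
    simp only [Pi.add_apply, ← Finset.sum_add_distrib]
    refine Finset.sum_congr rfl fun L _ => ?_
    split_ifs <;> simp
  map_smul' a c := by
    funext A
    simp [Finset.mul_sum]

theorem faceSum_apply {n : ℕ} (c : ChainCochain lam n) (A : FaceOfDim lam n) :
    faceSum lam n c A = ∑ L, Set.indicator {L | L.carrier = A.1} (extend c) L := by
  classical
  have h := sum_extend c fun L => if L.carrier = A.1 then 1 else 0
  simp only [mul_ite, mul_one, mul_zero] at h
  exact h.symm

theorem faceSum_chainCoboundary {n : ℕ} (c : ChainCochain lam n) :
    faceSum lam (n + 1) (chainCoboundary lam n c) = 0 := by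
  funext A
  have b := isBall_face A.2.1
  rw [faceSum_apply, extend_chainCoboundary, sum_indicator_vecMul]
  refine Finset.sum_eq_zero fun L _ => ?_
  by_cases h0 : extend c L = 0
  · rw [h0, zero_mul]
  by_cases hL : L.carrier = A.1
  · rw [b.even L hL (by rw [extend_ne_zero h0, A.2.2]), mul_zero]
  · rw [Finset.sum_eq_zero, mul_zero]
    intro M _
    by_cases hM : M.carrier = A.1
    · rw [Set.indicator_of_mem (show M ∈ {L | L.carrier = A.1} from hM)]
      exact carrierIncidence_of_ne fun h => hL (h.trans hM)
    · exact Set.indicator_of_notMem (s := {L : AdmChain lam | L.carrier = A.1}) hM _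

/-- The carriers split a coboundary into its parts on the faces. -/
theorem vecMul_carrierIncidence_eq {z z' : AdmChain lam → ZMod 2} {L' : AdmChain lam}
    (h : ∀ L : AdmChain lam, L.carrier = L'.carrier → z L = z' L) :
    (z ᵥ* carrierIncidence lam) L' = (z' ᵥ* carrierIncidence lam) L' := by
  refine Finset.sum_congr rfl fun L _ => ?_
  by_cases hL : L.carrier = L'.carrier
  · rw [h L hL]
  · have := carrierIncidence_of_ne hL
    exact (mul_eq_zero_of_right _ this).trans (mul_eq_zero_of_right _ this).symm

theorem mem_chainCoboundaries {n : ℕ} {c : ChainCochain lam n}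
    (hc : chainCoboundary lam n c = 0) (hs : faceSum lam n c = 0) :
    c ∈ chainCoboundaries lam n := by
  classical
  have hδ : extend c ᵥ* carrierIncidence lam = 0 := by
    rw [← extend_chainCoboundary, hc]
    funext L
    simp [extend]
  have hex : ∀ A : {A : Set (P → ℝ) // IsFace (orderPolytope lam) A},
      ∃ w : AdmChain lam → ZMod 2, (∀ L, w L ≠ 0 → L.carrier = A.1 ∧ L.dim + 1 = n) ∧
        ∀ L, L.carrier = A.1 → (w ᵥ* carrierIncidence lam) L = extend c L := by
    intro A
    obtain ⟨w, hw, hwz⟩ := (isBall_face A.2).exact n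
      (Set.indicator {L | L.carrier = A.1} (extend c)) (fun L hL => by
        have h1 := Set.mem_of_indicator_ne_zero hL
        rw [Set.indicator_of_mem h1] at hL
        exact ⟨h1, extend_ne_zero hL⟩) (fun L' hL' => by
        rw [vecMul_carrierIncidence_eq (z' := extend c) fun L hL =>
          Set.indicator_of_mem (show L ∈ {L | L.carrier = A.1} from hL.trans hL') _, hδ]
        rfl) (fun hn => by
        rw [← faceSum_apply c ⟨A.1, A.2, hn.symm⟩, hs]
        rfl)
    exact ⟨w, hw, fun L hL => (hwz L hL).trans (Set.indicator_of_mem (by exact hL) _)⟩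
  choose w hw hwz using hex
  -- Assemble the primitives on the faces to one cochain.
  let u : AdmChain lam → ZMod 2 := fun L => w ⟨L.carrier, L.isFace_carrier⟩ L
  have hu : u ᵥ* carrierIncidence lam = extend c := by
    funext L'
    rw [← hwz ⟨L'.carrier, L'.isFace_carrier⟩ L' rfl]
    refine vecMul_carrierIncidence_eq fun L hL => ?_
    simp only [u, hL]
  have hudim : ∀ L, u L ≠ 0 → L.dim + 1 = n := fun L hL => (hw _ L hL).2
  cases n with
  | zero =>
    have hu0 : u = 0 := by
      funext L
      by_contra h
      exact absurd (hudim L h) (Nat.succ_ne_zero _)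
    have : c = 0 := by
      apply extend_injective
      rw [← hu, hu0, zero_vecMul]
      funext L
      simp [extend]
    rw [this]
    exact Submodule.zero_mem _
  | succ m =>
    obtain ⟨e, he⟩ := exists_extend_eq fun L hL => Nat.succ_injective (hudim L hL)
    refine ⟨e, extend_injective ?_⟩
    rw [extend_chainCoboundary, he, hu]

/-- Top cells of the `n`-dimensional faces are cocycles, on which `faceSum` takes all values. -/
theorem exists_cocycle {n : ℕ} (g : FaceOfDim lam n → ZMod 2) :
    ∃ c : ChainCochain lam n, chainCoboundary lam n c = 0 ∧ faceSum lam n c = g := by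
  classical
  have htop : ∀ A : FaceOfDim lam n, ∃ L : AdmChain lam, L.carrier = A.1 ∧ L.dim = n := by
    intro A
    obtain ⟨L, hL, hd⟩ := (isBall_face A.2.1).exists_top
    exact ⟨L, hL, hd.trans A.2.2⟩
  choose top htop1 htop2 using htop
  let z : AdmChain lam → ZMod 2 := fun L =>
    if h : polyDim L.carrier = n then
      (if L = top ⟨L.carrier, L.isFace_carrier, h⟩ then g ⟨L.carrier, L.isFace_carrier, h⟩ else 0)
    else 0
  have hz : ∀ A : FaceOfDim lam n, ∀ L : AdmChain lam, L.carrier = A.1 →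
      z L = if L = top A then g A else 0 := by
    rintro ⟨_, hA, hd⟩ L rfl
    exact dif_pos hd
  have hz0 : ∀ L, z L ≠ 0 → polyDim L.carrier = n ∧ L.dim = n := by
    intro L hL
    by_cases h : polyDim L.carrier = n
    · refine ⟨h, ?_⟩
      rw [hz ⟨L.carrier, L.isFace_carrier, h⟩ L rfl] at hL
      have e : L = top ⟨L.carrier, L.isFace_carrier, h⟩ := by
        by_contra hne
        exact hL (if_neg hne)
      rw [e]
      exact htop2 _
    · exact absurd (dif_neg h) hL
  obtain ⟨c, hc⟩ := exists_extend_eq fun L hL => (hz0 L hL).2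
  refine ⟨c, extend_injective ?_, ?_⟩
  · rw [extend_chainCoboundary, hc]
    funext L'
    have h0 : extend (0 : ChainCochain lam (n + 1)) L' = 0 := by simp [extend]
    rw [h0]
    refine vecMul_apply_eq_zero fun L hL => ?_
    by_contra hne
    obtain ⟨h1, -, h3⟩ := carrierIncidence_ne_zero_iff.1 hne
    have h4 := (isBall_face L.isFace_carrier).dim_le L' h1.symm
    have := hz0 L hL
    omega
  · funext A
    rw [faceSum_apply, hc, Finset.sum_eq_single (top A)]
    · rw [Set.indicator_of_mem (show top A ∈ {L | L.carrier = A.1} from htop1 A),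
        hz A _ (htop1 A), if_pos rfl]
    · intro L _ hne
      by_cases hL : L.carrier = A.1
      · rw [Set.indicator_of_mem (show L ∈ {L | L.carrier = A.1} from hL), hz A L hL, if_neg hne]
      · exact Set.indicator_of_notMem (s := {L : AdmChain lam | L.carrier = A.1}) hL _
    · simp

theorem finrank_chainCohomology (n : ℕ) :
    (Module.finrank (ZMod 2) (ChainCohomology lam n) : ℕ∞) = faceNumber (orderPolytope lam) n := by
  have : Fintype (FaceOfDim lam n) := Fintype.ofFinite _
  let Ψ : LinearMap.ker (chainCoboundary lam n) →ₗ[ZMod 2] (FaceOfDim lam n → ZMod 2) :=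
    faceSum lam n ∘ₗ (LinearMap.ker (chainCoboundary lam n)).subtype
  have hsurj : Function.Surjective Ψ := fun g => by
    obtain ⟨c, h1, h2⟩ := exists_cocycle g
    exact ⟨⟨c, h1⟩, h2⟩
  have hker : (chainCoboundaries lam n).submoduleOf (LinearMap.ker (chainCoboundary lam n)) =
      LinearMap.ker Ψ := by
    ext ⟨c, hc⟩
    change c ∈ chainCoboundaries lam n ↔ faceSum lam n c = 0
    constructor
    · intro h
      cases n with
      | zero =>
        have h0 : c = 0 := h
        subst h0
        exact map_zero _
      | succ m =>
        obtain ⟨e, rfl⟩ := h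
        exact faceSum_chainCoboundary e
    · exact fun h => mem_chainCoboundaries hc h
  let e : ChainCohomology lam n ≃ₗ[ZMod 2] (FaceOfDim lam n → ZMod 2) :=
    (Submodule.quotEquivOfEq _ _ hker).trans (Ψ.quotKerEquivOfSurjective hsurj)
  rw [e.finrank_eq, Module.finrank_fintype_fun_eq_card]
  exact @Set.coe_fintypeCard _ {A | IsFace (orderPolytope lam) A ∧ polyDim A = n} ‹_›

end Cohomology

end MarkedPoset

/-- For a finite marked poset, `C^*(P, λ)` is a cochain complex, it is isomorphic to the complex of
the cubosimplicial subdivision of the marked order polytope, and the dimensions of its cohomology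
form the `f`-vector of that polytope. -/
theorem theorem1 {P : Type*} [PartialOrder P] [Finite P] (S : Set P)
    (hS : ∀ p : P, IsMin p ∨ IsMax p → p ∈ S) (lam : S → ℝ) (hlam : Monotone lam) :
    (∀ n : ℕ, MarkedPoset.chainCoboundary lam (n + 1) ∘ₗ MarkedPoset.chainCoboundary lam n = 0) ∧
    (∃ φ : ∀ n : ℕ, MarkedPoset.ChainCochain lam n ≃ₗ[ZMod 2]
        MarkedPoset.SubdivCochain (MarkedPoset.orderPolytope lam)
          (MarkedPoset.cubosimplicial lam) n,
      ∀ (n : ℕ) (c : MarkedPoset.ChainCochain lam n),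
        φ (n + 1) (MarkedPoset.chainCoboundary lam n c) =
          MarkedPoset.subdivCoboundary (MarkedPoset.orderPolytope lam)
            (MarkedPoset.cubosimplicial lam) n (φ n c)) ∧
    ∀ n : ℕ, (Module.finrank (ZMod 2) (MarkedPoset.ChainCohomology lam n) : ℕ∞) =
      MarkedPoset.faceNumber (MarkedPoset.orderPolytope lam) n := by
  exact ⟨fun n => MarkedPoset.chainCoboundary_comp n,
    ⟨MarkedPoset.cochainEquiv lam, MarkedPoset.cochainEquiv_chainCoboundary⟩,
    fun n => MarkedPoset.finrank_chainCohomology n⟩
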